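/- Let $N\ge 2$, $R>0$, and let $B_R\subset\mathbb R^N$ be the open ball of radius $R$ centered at the origin. Let $f\in L^1(B_R)$ be non-negative, radially symmetric and radially decreasing (i.e. $f(x)=g(|x|)$ for a.e. $x\in B_R$ with $g$ nonincreasing on $(0,R)$). Let $C_N$ be the measure of the unit ball of $\mathbb R^N$, let $f^*(s)=\inf\{\tau\ge0: |\{x\in B_R:|f(x)|>\tau\}|\le s\}$ be the decreasing rearrangement of $f$, and let $f^{**}(t)=\frac1t\int_0^t f^*(s)\,ds$ for $t>0$. For $\alpha>0$ put $H_\alpha(\xi)=(|\xi|-1)_+^\alpha\,\xi/|\xi|$ if $\xi\neq0$, and $H_\alpha(0)=0$. For $p>1$ consider the Dirichlet problem $$-\operatorname{div}\big(H_{p-1}(\nabla u)\big)=f\ \text{ in } B_R,\qquad u=0\ \text{ on }\partial B_R; \tag{1}$$ a solution of (1) is a $u\in W^{1,p}_0(B_R)$ with $\int_{B_R}\langle H_{p-1}(\nabla u),\nabla\varphi\rangle\,dx=\int_{B_R} f\varphi\,dx$ for all $\varphi\in C_0^\infty(B_R)$. Define $$z(x)=-\frac{f^{**}(C_N|x|^N)}{N}\,x,\qquad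 \tilde u_p(x)=\frac1{NC_N^{1/N}}\int_{C_N|x|^N}^{C_NR^N}\Big(1+\Big(\frac{s^{1/N}}{NC_N^{1/N}}f^{**}(s)\Big)^{\frac1{p-1}}\Big)s^{-1+\frac1N}\,ds .$$ Then $f^{**}(t)<\infty$ for all $t>0$, $z\in L^1(B_R;\mathbb R^N)$, and $-\operatorname{div}z=f$ in the sense of distributions on $B_R$. Moreover, for every $p>1$, with the same vector field $z$ (which does not depend on $p$): 1. every solution $u_p$ of (1) satisfies $H_{p-1}(\nabla u_p)=z$ a.e. in $B_R$, and $\nabla u_p=\nabla\tilde u_p$ a.e. in $\{|\nabla u_p|>1\}$; 2. $\tilde u_p$ is continuous on $\overline{B_R}\setminus\{0\}$, vanishes on $\partial B_R$, is differentiable in $B_R\setminus\{0\}$ with $\nabla\tilde u_p(x)=-\big[1+\big(\frac{|x|}{N}f^{**}(C_N|x|^N)\big)^{\frac1{p-1}}\big]\frac{x}{|x|}$, and satisfies $H_{p-1}(\nabla\tilde u_p)=z$ on $B_R\setminus\{0\}$; hence $-\operatorname{div}H_{p-1}(\nabla\tilde u_p)=f$ in the sense of distributions on $B_R$; 3. $\tilde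 u_p$ is itself a solution of (1) whenever (1) has a solution, and also whenever $\nabla\tilde u_p\in L^p(B_R)$; in particular it is a solution of (1) if $f\in L^{N,\infty}(B_R)$, i.e. if $\sup_{t>0}t^{1/N}f^{**}(t)<\infty$. -/

import Mathlib

open MeasureTheory Set Filter Topology
open scoped ENNReal ContDiff

noncomputable section

namespace WidelyDegenerate

/-- Euclidean space `ℝ^N`. -/
abbrev E (N : ℕ) : Type := EuclideanSpace ℝ (Fin N)

/-- The open ball `B_R` centered at the origin. -/
abbrev B (N : ℕ) (R : ℝ) : Set (E N) := Metric.ball (0 : E N) R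

/-- `C_N`, the Lebesgue measure of the unit ball of `ℝ^N`. -/
def C (N : ℕ) : ℝ := (volume (B N 1)).toReal

/-- The distribution function `μ_f(τ) = |{x ∈ Ω : |f(x)| > τ}|`. -/
def distribution {N : ℕ} (Ω : Set (E N)) (f : E N → ℝ) (τ : ℝ≥0∞) : ℝ≥0∞ :=
  volume {x ∈ Ω | τ < ‖f x‖ₑ}

/-- The decreasing rearrangement `f^*(s) = inf {τ ≥ 0 : μ_f(τ) ≤ s}` for `s ≥ 0`, with values
in `[0, ∞]` (the value `∞` is the infimum of the empty set of real levels). -/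
def rearrangement {N : ℕ} (Ω : Set (E N)) (f : E N → ℝ) (s : ℝ) : ℝ≥0∞ :=
  sInf {τ : ℝ≥0∞ | distribution Ω f τ ≤ ENNReal.ofReal s}

/-- The maximal function `f^{**}(t) = (1/t) ∫_0^t f^*(s) ds` for `t > 0`, with values
in `[0, ∞]`. -/
def maximalFunction {N : ℕ} (Ω : Set (E N)) (f : E N → ℝ) (t : ℝ) : ℝ≥0∞ :=
  (∫⁻ s in Ioo 0 t, rearrangement Ω f s) / ENNReal.ofReal t

/-- The Lorentz quasi-norm `sup_{t > 0} t^{1/r} f^{**}(t)` of `L^{r,∞}(Ω)`. -/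
def weakLorentzNorm {N : ℕ} (Ω : Set (E N)) (r : ℝ) (f : E N → ℝ) : ℝ≥0∞ :=
  ⨆ t : Ioi (0 : ℝ), ENNReal.ofReal ((t : ℝ) ^ (1 / r)) * maximalFunction Ω f t

/-- `H_α(ξ) = (|ξ| - 1)_+^α ξ / |ξ|` for `ξ ≠ 0`, and `H_α(0) = 0`. -/
def H {N : ℕ} (α : ℝ) (ξ : E N) : E N :=
  (max (‖ξ‖ - 1) 0) ^ α • (‖ξ‖⁻¹ • ξ)

/-- `f` agrees almost everywhere on `B_R` with a nonincreasing function of `|x|`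
(the profile may be unbounded near the origin). -/
def IsRadiallyDecreasing {N : ℕ} (R : ℝ) (f : E N → ℝ) : Prop :=
  ∃ g : ℝ → ℝ, AntitoneOn g (Ioo 0 R) ∧ ∀ᵐ x ∂(volume.restrict (B N R)), f x = g ‖x‖

/-- `φ ∈ C_0^∞(B_R)`. -/
structure IsTestFunction {N : ℕ} (R : ℝ) (φ : E N → ℝ) : Prop where
  smooth : ContDiff ℝ ∞ φ
  compact : HasCompactSupport φ
  support : tsupport φ ⊆ B N R

/-- `G` is the weak gradient of `u` on `B_R` (both locally integrable on `B_R`). -/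
structure HasWeakGradient {N : ℕ} (R : ℝ) (u : E N → ℝ) (G : E N → E N) : Prop where
  loc_fun : LocallyIntegrableOn u (B N R)
  loc_grad : LocallyIntegrableOn G (B N R)
  by_parts : ∀ φ : E N → ℝ, IsTestFunction R φ → ∀ v : E N,
    ∫ x in B N R, u x * inner ℝ (gradient φ x) v = -∫ x in B N R, inner ℝ (G x) v * φ x

/-- `u ∈ W_0^{1,p}(B_R)` with weak gradient `G`: `u` lies in `W^{1,p}(B_R)` and in the closure
of `C_0^∞(B_R)` for the norm of `W^{1,p}(B_R)`. -/
structure MemSobolevZero {N : ℕ} (R p : ℝ) (u : E N → ℝ) (G : E N → E N) : Prop where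
  memLp_fun : MemLp u (ENNReal.ofReal p) (volume.restrict (B N R))
  memLp_grad : MemLp G (ENNReal.ofReal p) (volume.restrict (B N R))
  weak_gradient : HasWeakGradient R u G
  approx : ∃ φ : ℕ → E N → ℝ, (∀ n, IsTestFunction R (φ n)) ∧
    Tendsto (fun n => eLpNorm (fun x => φ n x - u x) (ENNReal.ofReal p)
      (volume.restrict (B N R))) atTop (𝓝 0) ∧
    Tendsto (fun n => eLpNorm (fun x => gradient (φ n) x - G x) (ENNReal.ofReal p)
      (volume.restrict (B N R))) atTop (𝓝 0)

/-- `-div F = f` in the sense of distributions on `B_R`. -/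
def NegDivEq {N : ℕ} (R : ℝ) (F : E N → E N) (f : E N → ℝ) : Prop :=
  ∀ φ : E N → ℝ, IsTestFunction R φ →
    ∫ x in B N R, inner ℝ (F x) (gradient φ x) = ∫ x in B N R, f x * φ x

/-- `u ∈ W_0^{1,p}(B_R)`, with weak gradient `G`, is a weak solution of the Dirichlet problem
`-div ((|∇u| - 1)_+^{p-1} ∇u / |∇u|) = f` in `B_R`, `u = 0` on `∂B_R`. -/
structure IsWeakSolution {N : ℕ} (R p : ℝ) (f : E N → ℝ) (u : E N → ℝ) (G : E N → E N) :
    Prop where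
  memSobolevZero : MemSobolevZero R p u G
  equation : NegDivEq R (fun x => H (p - 1) (G x)) f

/-- The vector field `z(x) = -(f^{**}(C_N |x|^N) / N) x`. -/
def z {N : ℕ} (R : ℝ) (f : E N → ℝ) (x : E N) : E N :=
  -(((maximalFunction (B N R) f (C N * ‖x‖ ^ N)).toReal / N) • x)

/-- The explicit radial function
`ũ_p(x) = 1/(N C_N^{1/N}) ∫_{C_N |x|^N}^{C_N R^N}
  (1 + (s^{1/N} / (N C_N^{1/N}) f^{**}(s))^{1/(p-1)}) s^{-1+1/N} ds`. -/
def radialSolution {N : ℕ} (R p : ℝ) (f : E N → ℝ) (x : E N) : ℝ :=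
  1 / (N * C N ^ (1 / (N : ℝ))) *
    ∫ s in (C N * ‖x‖ ^ N)..(C N * R ^ N),
      (1 + (s ^ (1 / (N : ℝ)) / (N * C N ^ (1 / (N : ℝ))) *
        (maximalFunction (B N R) f s).toReal) ^ (1 / (p - 1))) * s ^ (-1 + 1 / (N : ℝ))

end WidelyDegenerate

end

/-! Write g for the radial profile of f, P(r) for the integral of s^(N-1) g(s) over (0, r), and p' =
p/(p-1). Because f decreases radially, f^*(C_N r^N) = g(r) for all but countably many r. So
f^{**}(C_N r^N) = N P(r)/r^N, the mean of f over B_r (`IsProfile.maximalFunction_eq`), and z =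
-r^(1-N) P(r) x/|x|. Integration by parts along each ray gives -div z = f (`IsProfile.negDivEq_z`).
The radial derivative of ũ_p is -(1 + |z|^(1/(p-1))), whose modulus is precisely the slope that
H_{p-1} turns into |z|; hence the flux of ũ_p is z.

H is monotone, and its monotonicity form vanishes only where the two fluxes coincide, so two
solutions share their flux (`IsWeakSolution.H_ae_eq`). Where |∇u| > 1, H is injective and the
gradient itself is recovered.

To compare an arbitrary solution with ũ_p, one needs ũ_p to be a solution as soon as any exists. A
radial function vanishing on the sphere lies in W_0^{1,p} once its gradient is in L^p
(`memSobolevZero_radial`), so the question is whether z lies in L^{p'}. This is a minimality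
property: every F in L^{p'} with -div F = f has at least the L^{p'} norm of z
(`IsProfile.setIntegral_flux_rpow_le`). To see this, test -div F = -div z against radial functions
whose gradients approximate the Young dual of z, and cut off near the origin. Then take F = H(∇u).
-/

noncomputable section

namespace WidelyDegenerate

/-! ### The map `H` -/

section H

variable {N : ℕ} {α : ℝ}

theorem norm_H (hα : 0 < α) (ξ : E N) : ‖H α ξ‖ = (max (‖ξ‖ - 1) 0) ^ α := by
  have h0 : (0 : ℝ) ≤ (max (‖ξ‖ - 1) 0) ^ α := Real.rpow_nonneg (le_max_right _ _) _
  rcases eq_or_ne ξ 0 with rfl | hξ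
  · simp [H, Real.zero_rpow hα.ne']
  · rw [H, norm_smul, norm_smul, norm_inv, norm_norm, inv_mul_cancel₀ (norm_ne_zero_iff.2 hξ),
      mul_one, Real.norm_of_nonneg h0]

theorem measurable_H (α : ℝ) : Measurable (H α : E N → E N) := by
  unfold H
  fun_prop

/-- The exponents α and 1/α cancel, so the slope 1 + A^(1/α) carries flux A. This dictates the form
of ũ_p; with A = 0 the slope is 1, where H vanishes. -/
theorem H_neg_smul (hα : 0 < α) {A : ℝ} (hA : 0 ≤ A) {e : E N} (he : ‖e‖ = 1) :
    H α (-((1 + A ^ (1 / α)) • e)) = -(A • e) := by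
  have hB : 0 ≤ A ^ (1 / α) := Real.rpow_nonneg hA _
  have hn : ‖-((1 + A ^ (1 / α)) • e)‖ = 1 + A ^ (1 / α) := by
    rw [norm_neg, norm_smul, he, mul_one, Real.norm_of_nonneg (by linarith)]
  rw [H, hn, add_sub_cancel_left, max_eq_left hB, ← Real.rpow_mul hA, one_div_mul_cancel hα.ne',
    Real.rpow_one, smul_neg, smul_neg, smul_smul _ _ e, inv_mul_cancel₀ (by linarith), one_smul]

/-- Polarization of the monotonicity form of `H`. -/
theorem inner_H_sub_H_sub (hα : 0 < α) (ξ η : E N) :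
    inner ℝ (H α ξ - H α η) (ξ - η) =
      ((max (‖ξ‖ - 1) 0) ^ α - (max (‖η‖ - 1) 0) ^ α) * (‖ξ‖ - ‖η‖) +
      ((max (‖ξ‖ - 1) 0) ^ α * ‖η‖ + (max (‖η‖ - 1) 0) ^ α * ‖ξ‖) *
        (1 - inner ℝ (‖ξ‖⁻¹ • ξ) (‖η‖⁻¹ • η)) := by
  have h0 : (0 : ℝ) ^ α = 0 := Real.zero_rpow hα.ne'
  -- The normalisation of the zero vector is zero rather than a unit vector, so zero arguments are
  -- checked apart.
  rcases eq_or_ne ξ 0 with rfl | hξ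
  · rcases eq_or_ne η 0 with rfl | hη
    · simp
    · have := norm_ne_zero_iff.2 hη
      simp [H, h0, real_inner_smul_left]
      field_simp
      simp
  · have hξ' := norm_ne_zero_iff.2 hξ
    rcases eq_or_ne η 0 with rfl | hη
    · simp [H, h0, real_inner_smul_left]
      field_simp
      simp
    · have hη' := norm_ne_zero_iff.2 hη
      simp only [H, inner_sub_left, inner_sub_right, real_inner_smul_left, real_inner_smul_right,
        real_inner_self_eq_norm_sq, real_inner_comm ξ η]
      field_simp
      ring

theorem norm_inv_smul_le (ξ : E N) : ‖‖ξ‖⁻¹ • ξ‖ ≤ 1 := by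
  rw [norm_smul, norm_inv, norm_norm]
  exact inv_mul_le_one

theorem inner_unit_le_one (ξ η : E N) : inner ℝ (‖ξ‖⁻¹ • ξ) (‖η‖⁻¹ • η) ≤ 1 :=
  (real_inner_le_norm _ _).trans
    (mul_le_one₀ (norm_inv_smul_le ξ) (norm_nonneg _) (norm_inv_smul_le η))

theorem max_rpow_mono (hα : 0 < α) {a b : ℝ} (h : a ≤ b) :
    (max (a - 1) 0) ^ α ≤ (max (b - 1) 0) ^ α :=
  Real.rpow_le_rpow (le_max_right _ _) (max_le_max_right _ (by linarith)) hα.le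

theorem max_rpow_sub_mul_nonneg (hα : 0 < α) (a b : ℝ) :
    0 ≤ ((max (a - 1) 0) ^ α - (max (b - 1) 0) ^ α) * (a - b) := by
  rcases le_total a b with h | h
  · exact mul_nonneg_of_nonpos_of_nonpos (sub_nonpos.2 (max_rpow_mono hα h)) (by linarith)
  · exact mul_nonneg (sub_nonneg.2 (max_rpow_mono hα h)) (by linarith)

theorem inner_H_sub_H_sub_nonneg (hα : 0 < α) (ξ η : E N) :
    0 ≤ inner ℝ (H α ξ - H α η) (ξ - η) := by
  rw [inner_H_sub_H_sub hα]
  have h1 := max_rpow_sub_mul_nonneg hα ‖ξ‖ ‖η‖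
  have h2 := inner_unit_le_one ξ η
  have : 0 ≤ (max (‖ξ‖ - 1) 0) ^ α := Real.rpow_nonneg (le_max_right _ _) _
  have : 0 ≤ (max (‖η‖ - 1) 0) ^ α := Real.rpow_nonneg (le_max_right _ _) _
  have : 0 ≤ 1 - inner ℝ (‖ξ‖⁻¹ • ξ) (‖η‖⁻¹ • η) := by linarith
  positivity

theorem one_lt_norm_of_max_rpow_ne_zero (hα : 0 < α) {a : ℝ} (h : (max (a - 1) 0) ^ α ≠ 0) :
    1 < a := by
  by_contra! h'
  rw [max_eq_right (by linarith), Real.zero_rpow hα.ne'] at h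
  exact h rfl

/-- Strict monotonicity of `H` modulo its degeneracy set. -/
theorem H_eq_H_of_inner_eq_zero (hα : 0 < α) {ξ η : E N}
    (h : inner ℝ (H α ξ - H α η) (ξ - η) = 0) : H α ξ = H α η := by
  rw [inner_H_sub_H_sub hα] at h
  have h1 := max_rpow_sub_mul_nonneg hα ‖ξ‖ ‖η‖
  have h2 := inner_unit_le_one ξ η
  have h3 : 0 ≤ (max (‖ξ‖ - 1) 0) ^ α := Real.rpow_nonneg (le_max_right _ _) _
  have h4 : 0 ≤ (max (‖η‖ - 1) 0) ^ α := Real.rpow_nonneg (le_max_right _ _) _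
  have h5 : 0 ≤ 1 - inner ℝ (‖ξ‖⁻¹ • ξ) (‖η‖⁻¹ • η) := by linarith
  have h6 : 0 ≤ ((max (‖ξ‖ - 1) 0) ^ α * ‖η‖ + (max (‖η‖ - 1) 0) ^ α * ‖ξ‖) *
        (1 - inner ℝ (‖ξ‖⁻¹ • ξ) (‖η‖⁻¹ • η)) := by positivity
  -- Two nonnegative terms with sum zero both vanish. The first forces equal moduli of the fluxes;
  -- if these are nonzero, the second is the equality case of Cauchy-Schwarz and forces equal
  -- directions.
  have h7 : ((max (‖ξ‖ - 1) 0) ^ α - (max (‖η‖ - 1) 0) ^ α) * (‖ξ‖ - ‖η‖) = 0 := by linarith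
  have h8 : ((max (‖ξ‖ - 1) 0) ^ α * ‖η‖ + (max (‖η‖ - 1) 0) ^ α * ‖ξ‖) *
        (1 - inner ℝ (‖ξ‖⁻¹ • ξ) (‖η‖⁻¹ • η)) = 0 := by linarith
  have h9 : (max (‖ξ‖ - 1) 0) ^ α = (max (‖η‖ - 1) 0) ^ α := by
    rcases mul_eq_zero.1 h7 with h | h
    · linarith
    · rw [sub_eq_zero.1 h]
  unfold H
  rw [← h9]
  by_cases h10 : (max (‖ξ‖ - 1) 0) ^ α = 0
  · simp [h10]
  have hξ := one_lt_norm_of_max_rpow_ne_zero hα h10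
  have hη := one_lt_norm_of_max_rpow_ne_zero hα (h9 ▸ h10)
  have h11 : 0 < (max (‖ξ‖ - 1) 0) ^ α := lt_of_le_of_ne h3 (Ne.symm h10)
  have h12 : inner ℝ (‖ξ‖⁻¹ • ξ) (‖η‖⁻¹ • η) = 1 := by
    rcases mul_eq_zero.1 h8 with h | h
    · have : 0 < (max (‖ξ‖ - 1) 0) ^ α * ‖η‖ + (max (‖η‖ - 1) 0) ^ α * ‖ξ‖ := by positivity
      linarith
    · linarith
  have hu : ∀ x : E N, 1 < ‖x‖ → ‖‖x‖⁻¹ • x‖ = 1 := fun x hx => by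
    rw [norm_smul, norm_inv, norm_norm, inv_mul_cancel₀ (by linarith)]
  rw [(inner_eq_one_iff_of_norm_eq_one (hu ξ hξ) (hu η hη)).1 h12]

/-- A nonzero flux determines the norm, as t ↦ (t-1)^α is injective on t ≥ 1, and then the
direction. Only one vector needs norm above 1: the other inherits it because its flux is nonzero. -/
theorem eq_of_H_eq (hα : 0 < α) {ξ η : E N} (hξ : 1 < ‖ξ‖) (h : H α ξ = H α η) : ξ = η := by
  have hn := congrArg norm h
  rw [norm_H hα, norm_H hα, max_eq_left (by linarith)] at hn
  have h1 : 0 < (‖ξ‖ - 1) ^ α := Real.rpow_pos_of_pos (by linarith) _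
  have hη : 1 < ‖η‖ := one_lt_norm_of_max_rpow_ne_zero hα (hn ▸ h1.ne')
  rw [max_eq_left (by linarith)] at hn
  have he : ‖ξ‖ = ‖η‖ := by
    have := (Real.rpow_left_inj (by linarith) (by linarith) hα.ne').1 hn
    linarith
  unfold H at h
  rw [he] at h h1 hξ
  rw [max_eq_left (by linarith)] at h
  exact smul_right_injective _ (inv_pos.2 (by linarith)).ne' (smul_right_injective _ h1.ne' h)

/-- The growth bound |H(G)| ≤ |G|^(p-1) puts fluxes of L^p gradients in the dual exponent, so they
can be paired with L^p gradients. -/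
theorem memLp_H {p : ℝ} (hp : 1 < p) {μ : Measure (E N)} {G : E N → E N}
    (hG : MemLp G (ENNReal.ofReal p) μ) :
    MemLp (fun x => H (p - 1) (G x)) (ENNReal.ofReal (p / (p - 1))) μ := by
  have h := hG.norm_rpow_div (ENNReal.ofReal (p - 1))
  rw [← ENNReal.ofReal_div_of_pos (by linarith), ENNReal.toReal_ofReal (by linarith)] at h
  refine h.of_le (((measurable_H _).comp_aemeasurable
    hG.aestronglyMeasurable.aemeasurable).aestronglyMeasurable) (ae_of_all _ fun x => ?_)
  rw [norm_H (by linarith), Real.norm_of_nonneg (by positivity)]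
  exact Real.rpow_le_rpow (le_max_right _ _) (max_le (by linarith) (norm_nonneg _)) (by linarith)

end H

/-! ### Duality pairings and density -/

section Lp

variable {X V : Type*} [MeasurableSpace X] {μ : Measure X} [NormedAddCommGroup V]
  [InnerProductSpace ℝ V] {p q : ℝ≥0∞}

theorem integrable_inner_of_memLp [p.HolderConjugate q] {F G : X → V} (hF : MemLp F p μ)
    (hG : MemLp G q μ) : Integrable (fun x => inner ℝ (F x) (G x)) μ :=
  memLp_one_iff_integrable.1 <| MemLp.of_bilin (p := p) (q := q) (fun a b => inner ℝ a b) 1 hF hG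
    (hF.1.inner hG.1) (ae_of_all _ fun x => by simpa using nnnorm_inner_le_nnnorm (𝕜 := ℝ) (F x) (G x))

/-- Hölder bounds the error by ‖F‖_p ‖g_n - G‖_q. This is how identities known for test functions
pass to their limits throughout. -/
theorem tendsto_integral_inner [p.HolderConjugate q] {F G : X → V} {g : ℕ → X → V}
    (hF : MemLp F p μ) (hG : MemLp G q μ) (hg : ∀ n, MemLp (g n) q μ)
    (h : Tendsto (fun n => eLpNorm (fun x => g n x - G x) q μ) atTop (𝓝 0)) :
    Tendsto (fun n => ∫ x, inner ℝ (F x) (g n x) ∂μ) atTop (𝓝 (∫ x, inner ℝ (F x) (G x) ∂μ)) := by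
  refine tendsto_integral_of_L1' _ (hF.1.inner hG.1)
    (Eventually.of_forall fun n => integrable_inner_of_memLp hF (hg n)) ?_
  have hb : ∀ n, eLpNorm ((fun x => inner ℝ (F x) (g n x)) - fun x => inner ℝ (F x) (G x)) 1 μ ≤
      eLpNorm F p μ * eLpNorm (fun x => g n x - G x) q μ := by
    intro n
    have := eLpNorm_le_eLpNorm_mul_eLpNorm_of_nnnorm (p := p) (q := q) (r := 1) hF.1 ((hg n).1.sub hG.1)
      (fun a b => inner ℝ a b) 1 (ae_of_all _ fun x => by
        simpa using nnnorm_inner_le_nnnorm (𝕜 := ℝ) (F x) ((g n - G) x))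
    simpa [inner_sub_right, Pi.sub_def] using this
  have := ENNReal.Tendsto.const_mul h (Or.inr hF.2.ne)
  rw [mul_zero] at this
  exact tendsto_of_tendsto_of_tendsto_of_le_of_le tendsto_const_nhds this (fun _ => zero_le) hb

/-- Dominated convergence with majorant |f|^p, since |χ - 1| ≤ 1. -/
theorem tendsto_eLpNorm_mul_sub_self (hp0 : p ≠ 0) (hp : p ≠ ⊤) {f : X → ℝ} (hf : MemLp f p μ)
    {χ : ℕ → X → ℝ} (hχm : ∀ n, AEStronglyMeasurable (χ n) μ) (hχ : ∀ n x, χ n x ∈ Icc (0 : ℝ) 1)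
    (hlim : ∀ᵐ x ∂μ, Tendsto (fun n => χ n x) atTop (𝓝 1)) :
    Tendsto (fun n => eLpNorm (fun x => χ n x * f x - f x) p μ) atTop (𝓝 0) := by
  have hpr : 0 < p.toReal := ENNReal.toReal_pos hp0 hp
  simp_rw [eLpNorm_eq_lintegral_rpow_enorm_toReal hp0 hp]
  have key : Tendsto (fun n => ∫⁻ x, ‖χ n x * f x - f x‖ₑ ^ p.toReal ∂μ) atTop
      (𝓝 (∫⁻ _, 0 ∂μ)) := by
    refine tendsto_lintegral_of_dominated_convergence' (fun x => ‖f x‖ₑ ^ p.toReal)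
      (fun n => ((((hχm n).mul hf.1).sub hf.1).enorm.pow_const _)) (fun n => ae_of_all _ fun x => ?_)
      ?_ ?_
    · refine ENNReal.rpow_le_rpow ?_ hpr.le
      have h1 := hχ n x
      rw [← ofReal_norm, ← ofReal_norm]
      apply ENNReal.ofReal_le_ofReal
      rw [show χ n x * f x - f x = -((1 - χ n x) * f x) by ring, norm_neg, norm_mul,
        Real.norm_of_nonneg (by linarith [h1.2])]
      exact mul_le_of_le_one_left (norm_nonneg _) (by linarith [h1.1])
    · have := hf.2
      rw [eLpNorm_lt_top_iff_lintegral_rpow_enorm_lt_top hp0 hp] at this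
      exact this.ne
    · filter_upwards [hlim] with x hx
      have h1 : Tendsto (fun n => ‖χ n x * f x - f x‖ₑ) atTop (𝓝 0) := by
        have := ((hx.mul_const (f x)).sub_const (f x)).enorm
        simpa using this
      have h2 := (ENNReal.continuous_rpow_const (y := p.toReal)).continuousAt.tendsto.comp h1
      simpa [Function.comp_def, ENNReal.zero_rpow_of_pos hpr] using h2
  rw [lintegral_zero] at key
  have h2 := (ENNReal.continuous_rpow_const (y := 1 / p.toReal)).continuousAt.tendsto.comp key
  simpa [Function.comp_def, ENNReal.zero_rpow_of_pos (inv_pos.2 hpr)] using h2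

end Lp

/-- Smooth cutoffs exhausting an open interval. -/
theorem exists_cutoff_Ioo (a b : ℝ) : ∃ χ : ℕ → ℝ → ℝ, (∀ n, ContDiff ℝ ∞ (χ n)) ∧
    (∀ n, HasCompactSupport (χ n)) ∧ (∀ n, tsupport (χ n) ⊆ Ioo a b) ∧
    (∀ n x, χ n x ∈ Icc (0 : ℝ) 1) ∧ ∀ x ∈ Ioo a b, Tendsto (fun n => χ n x) atTop (𝓝 1) := by
  obtain ⟨θ, hθs, hθd, hθr⟩ := (isOpen_Ioo (a := a) (b := b)).exists_contDiff_support_eq (n := ⊤)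
  have hpos : ∀ x, 0 ≤ θ x := fun x => (hθr (mem_range_self x)).1
  -- The shift by 1 makes the cutoff vanish wherever nθ ≤ 1. Its closed support then lies in {nθ ≥
  -- 1}, hence inside the open interval where θ > 0; it equals 1 once nθ ≥ 2.
  have hts : ∀ n : ℕ, tsupport (fun x => Real.smoothTransition (n * θ x - 1)) ⊆ Ioo a b := by
    intro n
    have h1 : tsupport (fun x => Real.smoothTransition (n * θ x - 1)) ⊆ {x | 1 ≤ n * θ x} := by
      refine closure_minimal (fun x hx => ?_)
        (isClosed_le continuous_const (continuous_const.mul hθd.continuous))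
      by_contra h
      simp only [mem_ofPred_eq, not_le] at h
      exact hx (Real.smoothTransition.zero_of_nonpos (by linarith))
    refine h1.trans fun x hx => ?_
    rw [← hθs, Function.mem_support]
    rintro h
    simp only [mem_ofPred_eq, h, mul_zero] at hx
    linarith
  refine ⟨fun n x => Real.smoothTransition (n * θ x - 1), fun n => ?_, fun n => ?_, hts,
    fun n x => ⟨Real.smoothTransition.nonneg _, Real.smoothTransition.le_one _⟩, fun x hx => ?_⟩
  · exact Real.smoothTransition.contDiff.comp ((contDiff_const.mul hθd).sub contDiff_const)
  · exact isCompact_Icc.of_isClosed_subset (isClosed_tsupport _) ((hts n).trans Ioo_subset_Icc_self)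
  · have hx0 : 0 < θ x := lt_of_le_of_ne (hpos x) (Ne.symm (by rwa [← hθs] at hx))
    refine tendsto_const_nhds.congr' ?_
    have : ∀ᶠ n : ℕ in atTop, 2 / θ x ≤ n := tendsto_natCast_atTop_atTop.eventually_ge_atTop _
    filter_upwards [this] with n hn
    rw [div_le_iff₀ hx0] at hn
    exact (Real.smoothTransition.one_of_one_le (by linarith)).symm

/-- Smooth functions with compact support in an open interval are dense in `L^p`. -/
theorem exists_smooth_tendsto_eLpNorm {ν : Measure ℝ} [IsFiniteMeasure ν] {a b : ℝ}
    (hν : ∀ᵐ r ∂ν, r ∈ Ioo a b) {p : ℝ≥0∞} (hp1 : 1 ≤ p) (hp : p ≠ ⊤) {w : ℝ → ℝ}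
    (hw : MemLp w p ν) :
    ∃ η : ℕ → ℝ → ℝ, (∀ n, ContDiff ℝ ∞ (η n)) ∧ (∀ n, HasCompactSupport (η n)) ∧
      (∀ n, tsupport (η n) ⊆ Ioo a b) ∧
      Tendsto (fun n => eLpNorm (fun r => η n r - w r) p ν) atTop (𝓝 0) := by
  obtain ⟨χ, hχd, hχc, hχs, hχr, hχl⟩ := exists_cutoff_Ioo a b
  have hp0 : p ≠ 0 := (zero_lt_one.trans_le hp1).ne'
  have main : ∀ n : ℕ, ∃ η : ℝ → ℝ, ContDiff ℝ ∞ η ∧ HasCompactSupport η ∧ tsupport η ⊆ Ioo a b ∧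
      eLpNorm (fun r => η r - w r) p ν ≤ ENNReal.ofReal (2 * (1 / ((n : ℝ) + 1))) := by
    intro n
    have hε : (0 : ℝ) < 1 / ((n : ℝ) + 1) := Nat.one_div_pos_of_nat
    -- This approximant is smooth with compact support in ℝ, but its support may leave (a, b);
    -- multiplying by a cutoff costs a second error of the same size, whence the factor 2.
    obtain ⟨g, hgc, hgd, hg⟩ := hw.exist_eLpNorm_sub_le hp hp1 hε
    have hgm : MemLp g p ν := hgd.continuous.memLp_of_hasCompactSupport hgc
    have hlim := tendsto_eLpNorm_mul_sub_self hp0 hp hgm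
      (fun n => (hχd n).continuous.aestronglyMeasurable) hχr
      (hν.mono fun r hr => hχl r hr)
    obtain ⟨k, hk⟩ := ((ENNReal.tendsto_atTop_zero.1 hlim) _ (ENNReal.ofReal_pos.2 hε))
    refine ⟨fun r => χ k r * g r, (hχd k).mul hgd, (hχc k).mul_right,
      (tsupport_mul_subset_left).trans (hχs k), ?_⟩
    have heq : (fun r => χ k r * g r - w r) = (fun r => χ k r * g r - g r) - (w - g) := by
      ext r; simp
    rw [heq]
    refine (eLpNorm_sub_le ?_ (hw.1.sub hgm.1) hp1).trans ?_
    · exact ((hχd k).continuous.mul hgd.continuous).aestronglyMeasurable.sub hgm.1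
    · rw [two_mul, ENNReal.ofReal_add hε.le hε.le]
      exact add_le_add (hk k le_rfl) hg
  choose η h1 h2 h3 h4 using main
  refine ⟨η, h1, h2, h3, ?_⟩
  refine tendsto_of_tendsto_of_tendsto_of_le_of_le tendsto_const_nhds ?_ (fun _ => zero_le) h4
  have := (ENNReal.continuous_ofReal.tendsto _).comp
    ((tendsto_one_div_add_atTop_nhds_zero_nat (𝕜 := ℝ)).const_mul 2)
  simpa [Function.comp_def] using this

/-! ### Polar coordinates -/

section Polar

variable {N : ℕ}

theorem nontrivial_E (hN : 2 ≤ N) : Nontrivial (E N) :=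
  Module.nontrivial_of_finrank_pos (R := ℝ) (by simp; omega)

/-- The constant is the total mass of the sphere measure. Measurability is asked only on the
positive half-line because the profiles used later are continuous only there. -/
theorem lintegral_fun_norm (hN : 2 ≤ N) {F : ℝ → ℝ≥0∞}
    (hF : Measurable fun r : Ioi (0 : ℝ) => F r) :
    ∫⁻ x : E N, F ‖x‖ = (N * volume (B N 1)) *
      ∫⁻ r in Ioi (0 : ℝ), ENNReal.ofReal (r ^ (N - 1)) * F r := by
  have := nontrivial_E hN
  have hd : Module.finrank ℝ (E N) = N := by simp
  calc ∫⁻ x : E N, F ‖x‖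
      = ∫⁻ x : ({(0 : E N)}ᶜ : Set (E N)), F ‖x.1‖ ∂(volume.comap Subtype.val) := by
        rw [lintegral_subtype_comap (measurableSet_singleton _).compl fun x : E N => F ‖x‖,
          restrict_compl_singleton]
    _ = ∫⁻ y, F y.2 ∂((volume : Measure (E N)).toSphere.prod (.volumeIoiPow (N - 1))) := by
        have h := (volume : Measure (E N)).measurePreserving_homeomorphUnitSphereProd
        rw [hd] at h
        simpa using h.lintegral_comp_emb (Homeomorph.measurableEmbedding _)
          fun y : Metric.sphere (0 : E N) 1 × Ioi (0 : ℝ) => F y.2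
    _ = (volume : Measure (E N)).toSphere univ * ∫⁻ r : Ioi (0 : ℝ), F r ∂.volumeIoiPow (N - 1) := by
        rw [← lintegral_map (μ := (volume : Measure (E N)).toSphere.prod (.volumeIoiPow (N - 1)))
          (f := fun r : Ioi (0 : ℝ) => F r) hF measurable_snd, Measure.map_snd_prod,
          lintegral_smul_measure, smul_eq_mul]
    _ = _ := by
        rw [Measure.toSphere_apply_univ, hd, Measure.volumeIoiPow,
          lintegral_withDensity_eq_lintegral_mul _ (by fun_prop) hF,
          ← lintegral_subtype_comap measurableSet_Ioi
            (fun r => ENNReal.ofReal (r ^ (N - 1)) * F r)]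
        rfl

theorem setLIntegral_ball_fun_norm (hN : 2 ≤ N) {F : ℝ → ℝ≥0∞} (R : ℝ)
    (hF : Measurable fun r : Ioi (0 : ℝ) => F r) :
    ∫⁻ x in B N R, F ‖x‖ = (N * volume (B N 1)) *
      ∫⁻ r in Ioo 0 R, ENNReal.ofReal (r ^ (N - 1)) * F r := by
  have h1 : ∫⁻ x in B N R, F ‖x‖ = ∫⁻ x : E N, (Iio R).indicator F ‖x‖ := by
    rw [← lintegral_indicator measurableSet_ball]
    refine lintegral_congr fun x => ?_
    simp [indicator]
  have h2 : Measurable fun r : Ioi (0 : ℝ) => (Iio R).indicator F r := by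
    have : (fun r : Ioi (0 : ℝ) => (Iio R).indicator F r) =
        ((fun r : Ioi (0 : ℝ) => (r : ℝ)) ⁻¹' (Iio R)).indicator (fun r : Ioi (0 : ℝ) => F r) := by
      ext r; simp [indicator]
    rw [this]
    exact hF.indicator (measurable_subtype_coe measurableSet_Iio)
  rw [h1, lintegral_fun_norm hN h2]
  congr 1
  rw [← Ioi_inter_Iio, inter_comm, ← setLIntegral_indicator measurableSet_Iio]
  refine lintegral_congr fun r => ?_
  by_cases hr : r < R <;> simp [hr]

/-- Integration in polar coordinates. -/
theorem integral_eq_integral_sphere (hN : 2 ≤ N) {F : E N → ℝ} (hF : Integrable F) :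
    ∫ x, F x = ∫ θ, (∫ r in Ioi (0 : ℝ), r ^ (N - 1) * F (r • (θ : E N)))
      ∂(volume : Measure (E N)).toSphere := by
  have := nontrivial_E hN
  have hd : Module.finrank ℝ (E N) = N := by simp
  have h := (volume : Measure (E N)).measurePreserving_homeomorphUnitSphereProd
  rw [hd] at h
  have hemb := Homeomorph.measurableEmbedding (homeomorphUnitSphereProd (E N))
  have hc : ∀ x : ({(0 : E N)}ᶜ : Set (E N)), F x.1 = (fun y : Metric.sphere (0 : E N) 1 × Ioi (0 : ℝ) =>
      F ((y.2 : ℝ) • (y.1 : E N))) (homeomorphUnitSphereProd (E N) x) := by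
    intro x
    have hx : ‖x.1‖ ≠ 0 := norm_ne_zero_iff.2 x.2
    simp [smul_smul, hx]
  have hint : Integrable (fun y : Metric.sphere (0 : E N) 1 × Ioi (0 : ℝ) =>
      F ((y.2 : ℝ) • (y.1 : E N)))
      ((volume : Measure (E N)).toSphere.prod (.volumeIoiPow (N - 1))) := by
    rw [← h.integrable_comp_emb hemb]
    have : (fun y : Metric.sphere (0 : E N) 1 × Ioi (0 : ℝ) => F ((y.2 : ℝ) • (y.1 : E N))) ∘
        (homeomorphUnitSphereProd (E N)) = F ∘ Subtype.val := by
      ext x; exact (hc x).symm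
    rw [this, ← integrableOn_iff_comap_subtypeVal (measurableSet_singleton _).compl]
    exact hF.integrableOn
  calc ∫ x, F x = ∫ x : ({(0 : E N)}ᶜ : Set (E N)), F x.1 ∂(volume.comap Subtype.val) := by
        rw [integral_subtype_comap (measurableSet_singleton _).compl F, restrict_compl_singleton]
    _ = ∫ y, F ((y.2 : ℝ) • (y.1 : E N))
          ∂((volume : Measure (E N)).toSphere.prod (.volumeIoiPow (N - 1))) := by
        rw [← h.integral_comp hemb]
        exact integral_congr_ae (ae_of_all _ hc)
    _ = ∫ θ, (∫ r : Ioi (0 : ℝ), F ((r : ℝ) • (θ : E N)) ∂(.volumeIoiPow (N - 1)))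
          ∂(volume : Measure (E N)).toSphere := integral_prod _ hint
    _ = _ := by
        refine integral_congr_ae (ae_of_all _ fun θ => ?_)
        simp only [Measure.volumeIoiPow, ENNReal.ofReal]
        rw [integral_withDensity_eq_integral_smul (by fun_prop),
          integral_subtype_comap measurableSet_Ioi
            fun a : ℝ => Real.toNNReal (a ^ (N - 1)) • F (a • (θ : E N))]
        refine setIntegral_congr_fun measurableSet_Ioi fun r hr => ?_
        simp only [NNReal.smul_def, smul_eq_mul]
        rw [Real.coe_toNNReal _ (pow_nonneg (le_of_lt hr) _)]

end Polar

/-! ### Radial functions -/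

section Radial

variable {N : ℕ} {R p : ℝ}

theorem hasGradientAt_norm {x : E N} (hx : x ≠ 0) :
    HasGradientAt (fun y : E N => ‖y‖) (‖x‖⁻¹ • x) x := by
  rw [hasGradientAt_iff_hasFDerivAt]
  have hx' := norm_ne_zero_iff.2 hx
  have h := (hasStrictFDerivAt_norm_sq x).hasFDerivAt.sqrt (by positivity)
  have h2 : (fun y : E N => Real.sqrt (‖y‖ ^ 2)) = fun y => ‖y‖ := by
    ext y; exact Real.sqrt_sq (norm_nonneg _)
  rw [h2] at h
  convert! h using 1
  ext y
  simp
  field_simp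

theorem hasGradientAt_comp_norm {ψ : ℝ → ℝ} {d : ℝ} {x : E N} (hx : x ≠ 0)
    (h : HasDerivAt ψ d ‖x‖) : HasGradientAt (fun y => ψ ‖y‖) (d • ‖x‖⁻¹ • x) x := by
  have h1 := (hasGradientAt_iff_hasFDerivAt.1 (hasGradientAt_norm hx))
  rw [hasGradientAt_iff_hasFDerivAt, map_smul]
  exact h.comp_hasFDerivAt x h1

/-- The radial function with radial derivative `η` vanishing on the sphere of radius `R`. -/
def radialPrimitive (N : ℕ) (R : ℝ) (η : ℝ → ℝ) (x : E N) : ℝ := -∫ s in ‖x‖..R, η s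

/-- The closed support misses 0 and R, hence neighbourhoods of both. The gap at 0 makes the radial
primitive constant near the origin; the gap at R keeps its support inside the ball. -/
theorem exists_Icc_of_tsupport_subset_Ioo {η : ℝ → ℝ}
    (hs : tsupport η ⊆ Ioo 0 R) : ∃ a b, 0 < a ∧ b < R ∧ ∀ r, r ∉ Icc a b → η r = 0 := by
  have h0 : (tsupport η)ᶜ ∈ 𝓝 (0 : ℝ) :=
    (isClosed_tsupport η).isOpen_compl.mem_nhds fun h => (lt_irrefl _ (hs h).1)
  have h1 : (tsupport η)ᶜ ∈ 𝓝 R :=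
    (isClosed_tsupport η).isOpen_compl.mem_nhds fun h => (lt_irrefl _ (hs h).2)
  obtain ⟨a, ha, ha'⟩ := Metric.mem_nhds_iff.1 h0
  obtain ⟨c, hc, hc'⟩ := Metric.mem_nhds_iff.1 h1
  refine ⟨a, R - c, ha, by linarith, fun r hr => ?_⟩
  by_contra hne
  have hrs : r ∈ tsupport η := subset_tsupport _ hne
  obtain ⟨hr0, hrR⟩ := hs hrs
  apply hr
  constructor
  · by_contra! h
    exact ha' (by simp [abs_of_pos hr0, h]) hrs
  · by_contra! h
    exact hc' (by rw [Metric.mem_ball, Real.dist_eq, abs_lt]; constructor <;> linarith) hrs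

theorem hasDerivAt_primitive {η : ℝ → ℝ} (hη : Continuous η) (R r : ℝ) :
    HasDerivAt (fun r => -∫ s in r..R, η s) (η r) r := by
  have := (intervalIntegral.integral_hasDerivAt_left (hη.intervalIntegrable r R)
    (hη.stronglyMeasurableAtFilter _ _) hη.continuousAt).neg
  rwa [neg_neg] at this

theorem contDiff_primitive {η : ℝ → ℝ} (hη : ContDiff ℝ ∞ η) (R : ℝ) :
    ContDiff ℝ ∞ (fun r => -∫ s in r..R, η s) := by
  have h := hasDerivAt_primitive hη.continuous R
  rw [contDiff_infty_iff_deriv]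
  refine ⟨fun r => (h r).differentiableAt, ?_⟩
  rwa [show deriv (fun r => -∫ s in r..R, η s) = η from funext fun r => (h r).deriv]

theorem radialPrimitive_eq_of_norm_le {η : ℝ → ℝ} (hη : Continuous η) {a b : ℝ}
    (hab : ∀ r, r ∉ Icc a b → η r = 0) {x : E N} (hx : ‖x‖ < a) :
    radialPrimitive N R η x = -∫ s in (0 : ℝ)..R, η s := by
  have h : ∫ s in (0 : ℝ)..‖x‖, η s = 0 := by
    rw [intervalIntegral.integral_congr (g := fun _ => 0), intervalIntegral.integral_zero]
    intro s hs
    rw [uIcc_of_le (norm_nonneg _)] at hs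
    exact hab s fun h => by linarith [hs.2, h.1]
  have := intervalIntegral.integral_add_adjacent_intervals
    (hη.intervalIntegrable 0 ‖x‖) (hη.intervalIntegrable (μ := volume) ‖x‖ R)
  rw [radialPrimitive]
  linarith

theorem hasGradientAt_radialPrimitive {η : ℝ → ℝ} (hη : Continuous η)
    (hs : tsupport η ⊆ Ioo 0 R) (x : E N) :
    HasGradientAt (radialPrimitive N R η) (η ‖x‖ • ‖x‖⁻¹ • x) x := by
  rcases eq_or_ne x 0 with rfl | hx
  · obtain ⟨a, b, ha, hb, hab⟩ := exists_Icc_of_tsupport_subset_Ioo hs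
    have : radialPrimitive N R η =ᶠ[𝓝 0] fun _ => -∫ s in (0 : ℝ)..R, η s := by
      filter_upwards [Metric.ball_mem_nhds (0 : E N) ha] with x hx
      exact radialPrimitive_eq_of_norm_le hη hab (by simpa using hx)
    rw [smul_zero, smul_zero]
    exact (hasGradientAt_const _ _).congr_of_eventuallyEq this
  · exact hasGradientAt_comp_norm hx (hasDerivAt_primitive hη R ‖x‖)

/-- The norm is not smooth at the origin, but the primitive is locally constant there; elsewhere it
is a composition of smooth maps. -/
theorem isTestFunction_radialPrimitive {η : ℝ → ℝ} (hη : ContDiff ℝ ∞ η)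
    (hs : tsupport η ⊆ Ioo 0 R) : IsTestFunction R (radialPrimitive N R η) := by
  obtain ⟨a, b, ha, hb, hab⟩ := exists_Icc_of_tsupport_subset_Ioo hs
  have hts : tsupport (radialPrimitive N R η) ⊆ Metric.closedBall 0 b := by
    refine closure_minimal (fun x hx => ?_) Metric.isClosed_closedBall
    by_contra h
    simp only [mem_closedBall_zero_iff, not_le] at h
    refine hx ?_
    rw [radialPrimitive, neg_eq_zero, intervalIntegral.integral_congr_ae (g := fun _ => 0),
      intervalIntegral.integral_zero]
    refine ae_of_all _ fun s hs' => hab s fun h' => ?_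
    rcases le_total ‖x‖ R with h1 | h1
    · rw [uIoc_of_le h1] at hs'
      linarith [hs'.1, h'.2]
    · rw [uIoc_of_ge h1] at hs'
      linarith [hs'.1, h'.2]
  refine ⟨?_, (isCompact_closedBall _ _).of_isClosed_subset (isClosed_tsupport _) hts,
    hts.trans (Metric.closedBall_subset_ball hb)⟩
  rw [contDiff_iff_contDiffAt]
  intro x
  rcases eq_or_ne x 0 with rfl | hx
  · refine (contDiffAt_const (c := -∫ s in (0 : ℝ)..R, η s)).congr_of_eventuallyEq ?_
    filter_upwards [Metric.ball_mem_nhds (0 : E N) ha] with x hx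
    exact radialPrimitive_eq_of_norm_le hη.continuous hab (by simpa using hx)
  · exact (contDiff_primitive hη R).contDiffAt.comp x (contDiffAt_norm ℝ hx)

/-- Poincaré inequality for radial functions. -/
theorem eLpNorm_radial_le (hN : 2 ≤ N) (hR : 0 < R) (hp : 1 < p) {W w : ℝ → ℝ}
    (hw : ContinuousOn w (Ioi 0)) (hW : ∀ r, 0 < r → HasDerivAt W (w r) r) (hWR : W R = 0) :
    eLpNorm (fun x : E N => W ‖x‖) (ENNReal.ofReal p) (volume.restrict (B N R)) ≤
      ENNReal.ofReal R *
        eLpNorm (fun x : E N => w ‖x‖) (ENNReal.ofReal p) (volume.restrict (B N R)) := by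
  have hp0 : 0 < p := by linarith
  have hpe : ENNReal.ofReal p ≠ 0 := (ENNReal.ofReal_pos.2 hp0).ne'
  have hpt : ENNReal.ofReal p ≠ ⊤ := ENNReal.ofReal_ne_top
  have hWc : ContinuousOn W (Ioi 0) := fun r hr => (hW r hr).continuousAt.continuousWithinAt
  have hmeas : ∀ {v : ℝ → ℝ}, ContinuousOn v (Ioi 0) →
      Measurable fun r : Ioi (0 : ℝ) => ‖v r‖ₑ ^ p := fun {v} hv =>
    ((continuousOn_iff_continuous_domRestrict.1 hv).measurable.enorm.pow_const p)
  -- W is integrated inward from the sphere, so only s > r occurs and the weight r^(N-1) is at most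
  -- s^(N-1). Hölder on (r, R) costs R^(p-1), and the later integration in r over (0, R) supplies
  -- the remaining factor R.
  have hbound : ∀ r ∈ Ioo 0 R, ENNReal.ofReal (r ^ (N - 1)) * ‖W r‖ₑ ^ p ≤
      ENNReal.ofReal R ^ (p - 1) *
        ∫⁻ s in Ioo 0 R, ENNReal.ofReal (s ^ (N - 1)) * ‖w s‖ₑ ^ p := by
    intro r hr
    have hsub : uIcc r R ⊆ Ioi 0 := by
      rw [uIcc_of_le hr.2.le]
      exact fun s hs => lt_of_lt_of_le hr.1 hs.1
    have hftc : ∫ s in r..R, w s = -W r := by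
      rw [intervalIntegral.integral_eq_sub_of_hasDerivAt (fun s hs => hW s (hsub hs))
        (hw.mono hsub).intervalIntegrable, hWR, zero_sub]
    have h1 : ‖W r‖ₑ ≤ ∫⁻ s in Ioo r R, ‖w s‖ₑ := by
      rw [← enorm_neg, ← hftc, intervalIntegral.integral_of_le hr.2.le,
        integral_Ioc_eq_integral_Ioo]
      exact enorm_integral_le_lintegral_enorm _
    have hwm : AEStronglyMeasurable w (volume.restrict (Ioo r R)) :=
      (hw.mono fun s hs => hr.1.trans hs.1).aestronglyMeasurable measurableSet_Ioo
    have h2 := eLpNorm'_le_eLpNorm'_mul_rpow_measure_univ (μ := volume.restrict (Ioo r R))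
      zero_lt_one hp.le hwm
    simp only [eLpNorm', ENNReal.rpow_one, div_one, Measure.restrict_apply_univ,
      Real.volume_Ioo] at h2
    have h3 : ‖W r‖ₑ ^ p ≤ (∫⁻ s in Ioo r R, ‖w s‖ₑ ^ p) * ENNReal.ofReal R ^ (p - 1) := by
      refine (ENNReal.rpow_le_rpow (h1.trans h2) hp0.le).trans ?_
      rw [ENNReal.mul_rpow_of_nonneg _ _ hp0.le, ← ENNReal.rpow_mul, ← ENNReal.rpow_mul,
        one_div_mul_cancel hp0.ne', ENNReal.rpow_one, sub_mul, one_div_mul_cancel hp0.ne', one_mul]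
      gcongr
      linarith [hr.1]
    calc ENNReal.ofReal (r ^ (N - 1)) * ‖W r‖ₑ ^ p
        ≤ ENNReal.ofReal (r ^ (N - 1)) *
          ((∫⁻ s in Ioo r R, ‖w s‖ₑ ^ p) * ENNReal.ofReal R ^ (p - 1)) := by gcongr
      _ = ENNReal.ofReal R ^ (p - 1) *
          ∫⁻ s in Ioo r R, ENNReal.ofReal (r ^ (N - 1)) * ‖w s‖ₑ ^ p := by
        rw [lintegral_const_mul' _ _ ENNReal.ofReal_ne_top]
        ring
      _ ≤ ENNReal.ofReal R ^ (p - 1) *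
          ∫⁻ s in Ioo r R, ENNReal.ofReal (s ^ (N - 1)) * ‖w s‖ₑ ^ p := by
        refine mul_le_mul_right ?_ _
        refine setLIntegral_mono' measurableSet_Ioo fun s hs => ?_
        have := pow_le_pow_left₀ hr.1.le hs.1.le (N - 1)
        gcongr
      _ ≤ _ := by
        gcongr
        exact hr.1.le
  have hmain : ∫⁻ x in B N R, ‖W ‖x‖‖ₑ ^ p ≤
      ENNReal.ofReal R ^ p * ∫⁻ x in B N R, ‖w ‖x‖‖ₑ ^ p := by
    rw [setLIntegral_ball_fun_norm hN (F := fun r => ‖W r‖ₑ ^ p) R (hmeas hWc),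
      setLIntegral_ball_fun_norm hN (F := fun r => ‖w r‖ₑ ^ p) R (hmeas hw)]
    calc _ ≤ (N * volume (B N 1)) * ∫⁻ r in Ioo 0 R, ENNReal.ofReal R ^ (p - 1) *
          ∫⁻ s in Ioo 0 R, ENNReal.ofReal (s ^ (N - 1)) * ‖w s‖ₑ ^ p := by
          refine mul_le_mul_right ?_ _
          exact setLIntegral_mono' measurableSet_Ioo hbound
      _ = _ := by
          rw [setLIntegral_const, Real.volume_Ioo, sub_zero]
          have : ENNReal.ofReal R ^ p = ENNReal.ofReal R ^ (p - 1) * ENNReal.ofReal R := by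
            conv_lhs => rw [show p = (p - 1) + 1 by ring, ENNReal.rpow_add _ _
              (ENNReal.ofReal_pos.2 hR).ne' ENNReal.ofReal_ne_top, ENNReal.rpow_one]
          rw [this]
          ring
  rw [eLpNorm_eq_lintegral_rpow_enorm_toReal hpe hpt, eLpNorm_eq_lintegral_rpow_enorm_toReal hpe hpt,
    ENNReal.toReal_ofReal hp0.le]
  refine (ENNReal.rpow_le_rpow hmain (by positivity)).trans ?_
  rw [ENNReal.mul_rpow_of_nonneg _ _ (by positivity), ← ENNReal.rpow_mul,
    mul_one_div_cancel hp0.ne', ENNReal.rpow_one]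

end Radial

/-! ### Sobolev functions -/

section Sobolev

variable {N : ℕ} {R p : ℝ}

theorem continuous_gradient_of_contDiff {φ : E N → ℝ} (hφ : ContDiff ℝ ∞ φ) :
    Continuous (gradient φ) :=
  (LinearIsometryEquiv.continuous _).comp (hφ.continuous_fderiv (by simp))

theorem gradient_eq_zero_of_notMem_tsupport {φ : E N → ℝ} {x : E N} (hx : x ∉ tsupport φ) :
    gradient φ x = 0 := by
  have : fderiv ℝ φ x = 0 := by
    by_contra h
    exact hx (support_fderiv_subset ℝ h)
  simp [gradient, this]

theorem IsTestFunction.hasCompactSupport_gradient {φ : E N → ℝ} (hφ : IsTestFunction R φ) :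
    HasCompactSupport (gradient φ) :=
  HasCompactSupport.intro hφ.compact fun _ hx => gradient_eq_zero_of_notMem_tsupport hx

theorem IsTestFunction.continuous_gradient {φ : E N → ℝ} (hφ : IsTestFunction R φ) :
    Continuous (gradient φ) := continuous_gradient_of_contDiff hφ.smooth

theorem IsTestFunction.eq_zero {φ : E N → ℝ} (hφ : IsTestFunction R φ) {x : E N}
    (hx : x ∉ B N R) : φ x = 0 :=
  image_eq_zero_of_notMem_tsupport fun h => hx (hφ.support h)

theorem IsTestFunction.gradient_eq_zero {φ : E N → ℝ} (hφ : IsTestFunction R φ) {x : E N}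
    (hx : x ∉ B N R) : gradient φ x = 0 :=
  gradient_eq_zero_of_notMem_tsupport fun h => hx (hφ.support h)

theorem IsTestFunction.memLp {φ : E N → ℝ} (hφ : IsTestFunction R φ) (q : ℝ≥0∞) :
    MemLp φ q (volume.restrict (B N R)) :=
  (hφ.smooth.continuous.memLp_of_hasCompactSupport hφ.compact).restrict _

theorem IsTestFunction.memLp_gradient {φ : E N → ℝ} (hφ : IsTestFunction R φ) (q : ℝ≥0∞) :
    MemLp (gradient φ) q (volume.restrict (B N R)) :=
  (hφ.continuous_gradient.memLp_of_hasCompactSupport hφ.hasCompactSupport_gradient).restrict _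

theorem IsTestFunction.by_parts {u φ : E N → ℝ} (hu : IsTestFunction R u)
    (hφ : IsTestFunction R φ) (v : E N) :
    ∫ x in B N R, u x * inner ℝ (gradient φ x) v =
      -∫ x in B N R, inner ℝ (gradient u x) v * φ x := by
  rw [setIntegral_eq_integral_of_forall_compl_eq_zero
      (fun x hx => by rw [hu.eq_zero hx, zero_mul]),
    setIntegral_eq_integral_of_forall_compl_eq_zero
      (fun x hx => by rw [hφ.eq_zero hx, mul_zero])]
  simp_rw [inner_gradient_left]
  have hc : ∀ {f : E N → ℝ}, IsTestFunction R f → Continuous fun x => fderiv ℝ f x v := fun hf =>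
    (hf.smooth.continuous_fderiv (by simp)).clm_apply continuous_const
  refine integral_mul_fderiv_eq_neg_fderiv_mul_of_integrable ?_ ?_ ?_
    (fun x _ => hu.smooth.contDiffAt.differentiableAt (by simp))
    (fun x _ => hφ.smooth.contDiffAt.differentiableAt (by simp))
  · exact ((hc hu).mul hφ.smooth.continuous).integrable_of_hasCompactSupport hφ.compact.mul_left
  · exact (hu.smooth.continuous.mul (hc hφ)).integrable_of_hasCompactSupport hu.compact.mul_right
  · exact (hu.smooth.continuous.mul hφ.smooth.continuous).integrable_of_hasCompactSupport
      hu.compact.mul_right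

theorem holderConjugate_ofReal (hp : 1 < p) :
    ENNReal.HolderConjugate (ENNReal.ofReal (p / (p - 1))) (ENNReal.ofReal p) :=
  ((Real.holderConjugate_iff_eq_conjExponent hp).2 rfl).symm.ennrealOfReal

/-- Limits of test functions in `W^{1,p}` are in `W_0^{1,p}`. -/
theorem memSobolevZero_of_tendsto (hp : 1 < p) {u : E N → ℝ} {G : E N → E N}
    (hu : MemLp u (ENNReal.ofReal p) (volume.restrict (B N R)))
    (hG : MemLp G (ENNReal.ofReal p) (volume.restrict (B N R)))
    {φ : ℕ → E N → ℝ} (hφ : ∀ n, IsTestFunction R (φ n))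
    (hφu : Tendsto (fun n => eLpNorm (fun x => φ n x - u x) (ENNReal.ofReal p)
      (volume.restrict (B N R))) atTop (𝓝 0))
    (hφG : Tendsto (fun n => eLpNorm (fun x => gradient (φ n) x - G x) (ENNReal.ofReal p)
      (volume.restrict (B N R))) atTop (𝓝 0)) : MemSobolevZero R p u G := by
  have hp1 : 1 ≤ ENNReal.ofReal p := by
    rw [← ENNReal.ofReal_one]; exact ENNReal.ofReal_le_ofReal hp.le
  have := holderConjugate_ofReal hp
  have hfin : IsFiniteMeasure (volume.restrict (B N R)) := ⟨by
    rw [Measure.restrict_apply_univ]; exact measure_ball_lt_top⟩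
  have hloc : ∀ {V : Type} [NormedAddCommGroup V] {F : E N → V},
      MemLp F (ENNReal.ofReal p) (volume.restrict (B N R)) → LocallyIntegrableOn F (B N R) :=
    fun hF => IntegrableOn.locallyIntegrableOn (hF.integrable hp1)
  refine ⟨hu, hG, ⟨hloc hu, hloc hG, fun ψ hψ v => ?_⟩, φ, hφ, hφu, hφG⟩
  have hψ1 : MemLp (fun x => inner ℝ (gradient ψ x) v) (ENNReal.ofReal (p / (p - 1)))
      (volume.restrict (B N R)) := by
    refine MemLp.restrict _ (Continuous.memLp_of_hasCompactSupport
      (hψ.continuous_gradient.inner continuous_const) ?_)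
    exact hψ.hasCompactSupport_gradient.comp_left (g := fun y => inner ℝ y v) (by simp)
  have hψ2 : MemLp (fun x => ψ x • v) (ENNReal.ofReal (p / (p - 1)))
      (volume.restrict (B N R)) :=
    MemLp.restrict _ (Continuous.memLp_of_hasCompactSupport
      (hψ.smooth.continuous.smul continuous_const) hψ.compact.smul_right)
  -- For fixed ψ both sides of the integration by parts are continuous under the assumed L^p
  -- convergences, so the identity passes from the test functions to the limit.
  have h1 := tendsto_integral_inner hψ1 hu (fun n => (hφ n).memLp _) hφu
  have h2 := tendsto_integral_inner hψ2 hG (fun n => (hφ n).memLp_gradient _) hφG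
  have h3 : ∀ n, ∫ x in B N R, inner ℝ (inner ℝ (gradient ψ x) v) (φ n x) =
      -∫ x in B N R, inner ℝ (ψ x • v) (gradient (φ n) x) := by
    intro n
    simp only [real_inner_smul_left, real_inner_comm (gradient (φ n) _) v]
    have := (hφ n).by_parts hψ v
    simpa [mul_comm] using this
  have h4 := tendsto_nhds_unique h1 ((h2.neg).congr fun n => (h3 n).symm)
  simp only [real_inner_smul_left] at h4
  simp only [Real.inner_apply] at h4
  simpa only [mul_comm, real_inner_comm] using h4

theorem isFiniteMeasure_restrict_ball : IsFiniteMeasure (volume.restrict (B N R)) :=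
  ⟨by rw [Measure.restrict_apply_univ]; exact measure_ball_lt_top⟩

theorem ae_restrict_ball_mem (hN : 2 ≤ N) :
    ∀ᵐ x ∂(volume.restrict (B N R)), x ∈ B N R ∧ x ≠ 0 := by
  have := nontrivial_E hN
  filter_upwards [ae_restrict_mem measurableSet_ball,
    (Measure.ae_ne (volume.restrict (B N R)) (0 : E N))] with x h1 h2 using ⟨h1, h2⟩

/-- The radial unit vector field. -/
def unitField (x : E N) : E N := ‖x‖⁻¹ • x

theorem norm_unitField {x : E N} (hx : x ≠ 0) : ‖unitField x‖ = 1 := by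
  rw [unitField, norm_smul, norm_inv, norm_norm, inv_mul_cancel₀ (norm_ne_zero_iff.2 hx)]

theorem norm_smul_unitField_le (c : ℝ) (x : E N) : ‖c • unitField x‖ ≤ ‖c‖ := by
  rw [norm_smul]
  exact mul_le_of_le_one_right (norm_nonneg _) (norm_inv_smul_le x)

theorem measurable_unitField : Measurable (unitField : E N → E N) := by
  unfold unitField
  fun_prop

/-- Approximation of radial fields by gradients of radial test functions. -/
theorem exists_radial_tendsto {a b : ℝ} (hp : 1 ≤ p) {w : ℝ → ℝ}
    {μ : Measure (E N)} [IsFiniteMeasure μ]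
    (hμ : ∀ᵐ x ∂μ, ‖x‖ ∈ Ioo a b)
    (hw : MemLp (fun x : E N => w ‖x‖) (ENNReal.ofReal p) μ)
    (hwν : AEStronglyMeasurable w (μ.map norm)) :
    ∃ η : ℕ → ℝ → ℝ, (∀ n, ContDiff ℝ ∞ (η n)) ∧ (∀ n, tsupport (η n) ⊆ Ioo a b) ∧
      Tendsto (fun n => eLpNorm (fun x : E N => η n ‖x‖ - w ‖x‖) (ENNReal.ofReal p) μ)
        atTop (𝓝 0) := by
  have hp1 : 1 ≤ ENNReal.ofReal p := by
    rw [← ENNReal.ofReal_one]; exact ENNReal.ofReal_le_ofReal hp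
  have hnm : AEMeasurable (fun x : E N => ‖x‖) μ := measurable_norm.aemeasurable
  -- Pushing μ forward under the norm reduces the approximation to density on an interval of the
  -- line.
  have h1 : MemLp w (ENNReal.ofReal p) (μ.map norm) := (memLp_map_measure_iff hwν hnm).2 hw
  have h2 : ∀ᵐ r ∂(μ.map norm), r ∈ Ioo a b := (ae_map_iff hnm measurableSet_Ioo).2 hμ
  have : IsFiniteMeasure (μ.map norm) := Measure.isFiniteMeasure_map μ _
  obtain ⟨η, hd, hc, hs, hl⟩ := exists_smooth_tendsto_eLpNorm h2 hp1 ENNReal.ofReal_ne_top h1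
  refine ⟨η, hd, hs, hl.congr fun n => ?_⟩
  exact eLpNorm_map_measure ((hd n).continuous.aestronglyMeasurable.sub hwν) hnm

theorem aestronglyMeasurable_map_norm {w : ℝ → ℝ} (hw : ContinuousOn w (Ioi 0))
    {μ : Measure (E N)} (hμ : ∀ᵐ x ∂μ, x ≠ 0) : AEStronglyMeasurable w (μ.map norm) := by
  have h : ∀ᵐ r ∂(μ.map norm), r ∈ Ioi (0 : ℝ) :=
    (ae_map_iff measurable_norm.aemeasurable measurableSet_Ioi).2
      (hμ.mono fun x hx => norm_pos_iff.2 hx)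
  rw [← Measure.restrict_eq_self_of_ae_mem h]
  exact hw.aestronglyMeasurable measurableSet_Ioi

theorem aestronglyMeasurable_of_continuousOn_compl_zero {V : Type*} [TopologicalSpace V]
    [TopologicalSpace.PseudoMetrizableSpace V] [SecondCountableTopology V] {F : E N → V}
    (hF : ContinuousOn F {0}ᶜ)
    {μ : Measure (E N)} (hμ : ∀ᵐ x ∂μ, x ≠ 0) : AEStronglyMeasurable F μ := by
  rw [← Measure.restrict_eq_self_of_ae_mem (s := {(0 : E N)}ᶜ) hμ]
  exact hF.aestronglyMeasurable (measurableSet_singleton _).compl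

theorem continuousOn_comp_norm {w : ℝ → ℝ} (hw : ContinuousOn w (Ioi 0)) :
    ContinuousOn (fun x : E N => w ‖x‖) {0}ᶜ :=
  hw.comp continuous_norm.continuousOn fun _ hx => norm_pos_iff.2 hx

/-- A radial function vanishing on the sphere of radius `R` with `p`-integrable radial derivative
lies in `W_0^{1,p}(B_R)`. -/
theorem memSobolevZero_radial (hN : 2 ≤ N) (hR : 0 < R) (hp : 1 < p) {W w : ℝ → ℝ}
    (hw : ContinuousOn w (Ioi 0)) (hW : ∀ r, 0 < r → HasDerivAt W (w r) r) (hWR : W R = 0)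
    (hmem : MemLp (fun x : E N => w ‖x‖) (ENNReal.ofReal p) (volume.restrict (B N R)))
    {G : E N → E N} (hG : G =ᵐ[volume.restrict (B N R)] fun x => w ‖x‖ • unitField x) :
    MemSobolevZero R p (fun x => W ‖x‖) G := by
  have := isFiniteMeasure_restrict_ball (N := N) (R := R)
  have hmem0 := ae_restrict_ball_mem (R := R) hN
  have hne : ∀ᵐ x ∂(volume.restrict (B N R)), x ≠ 0 := hmem0.mono fun _ h => h.2
  have hWc : ContinuousOn W (Ioi 0) := fun r hr => (hW r hr).continuousAt.continuousWithinAt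
  obtain ⟨η, hηd, hηs, hηl⟩ := exists_radial_tendsto (a := 0) (b := R) hp.le
    (μ := volume.restrict (B N R))
    (hmem0.mono fun x h => ⟨norm_pos_iff.2 h.2, by simpa using h.1⟩) hmem
    (aestronglyMeasurable_map_norm hw hne)
  have hgrad : ∀ n x, gradient (radialPrimitive N R (η n)) x = η n ‖x‖ • unitField x :=
    fun n x => (hasGradientAt_radialPrimitive (hηd n).continuous (hηs n) x).gradient
  refine memSobolevZero_of_tendsto hp ⟨?_, ?_⟩ ?_
    (fun n => isTestFunction_radialPrimitive (hηd n) (hηs n)) ?_ ?_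
  · exact aestronglyMeasurable_of_continuousOn_compl_zero (continuousOn_comp_norm hWc) hne
  · exact (eLpNorm_radial_le hN hR hp hw hW hWR).trans_lt
      (ENNReal.mul_lt_top ENNReal.ofReal_lt_top hmem.2)
  · rw [memLp_congr_ae hG]
    exact hmem.of_le (hmem.1.smul measurable_unitField.aestronglyMeasurable)
      (ae_of_all _ fun x => norm_smul_unitField_le _ _)
  -- The difference is again radial, vanishes at R and has radial derivative η_n - w, so the
  -- Poincaré inequality converts gradient convergence into convergence of the functions.
  · have hb : ∀ n, eLpNorm (fun x => radialPrimitive N R (η n) x - W ‖x‖) (ENNReal.ofReal p)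
        (volume.restrict (B N R)) ≤ ENNReal.ofReal R *
        eLpNorm (fun x : E N => η n ‖x‖ - w ‖x‖) (ENNReal.ofReal p) (volume.restrict (B N R)) :=
      fun n => eLpNorm_radial_le hN hR hp (W := fun r => (-∫ s in r..R, η n s) - W r)
        (w := fun r => η n r - w r) ((hηd n).continuous.continuousOn.sub hw)
        (fun r hr => (hasDerivAt_primitive (hηd n).continuous R r).sub (hW r hr)) (by simp [hWR])
    have := ENNReal.Tendsto.const_mul hηl (Or.inr (ENNReal.ofReal_ne_top (r := R)))
    rw [mul_zero] at this
    exact tendsto_of_tendsto_of_tendsto_of_le_of_le tendsto_const_nhds this (fun _ => zero_le) hb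
  · refine tendsto_of_tendsto_of_tendsto_of_le_of_le tendsto_const_nhds hηl (fun _ => zero_le)
      fun n => eLpNorm_mono_ae ?_
    filter_upwards [hG] with x hx
    rw [hx, hgrad, ← sub_smul]
    exact norm_smul_unitField_le _ _

end Sobolev

/-! ### The rearrangement of a radially decreasing function -/

section Rearrangement

variable {N : ℕ} {R : ℝ} {f : E N → ℝ} {g : ℝ → ℝ}

theorem C_pos (N : ℕ) : 0 < C N :=
  ENNReal.toReal_pos (Metric.measure_ball_pos _ _ one_pos).ne' measure_ball_lt_top.ne

theorem ofReal_C (N : ℕ) : ENNReal.ofReal (C N) = volume (B N 1) :=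
  ENNReal.ofReal_toReal measure_ball_lt_top.ne

theorem volume_ball_eq {r : ℝ} (hr : 0 < r) : volume (B N r) = ENNReal.ofReal (C N * r ^ N) := by
  rw [Measure.addHaar_ball_of_pos _ _ hr, mul_comm (C N), ENNReal.ofReal_mul (by positivity),
    ofReal_C]
  simp

/-- `g` is a nonnegative nonincreasing radial profile of the integrable function `f` on `B_R`,
extended by zero. -/
structure IsProfile (R : ℝ) (f : E N → ℝ) (g : ℝ → ℝ) : Prop where
  antitone : AntitoneOn g (Ioi 0)
  nonneg : ∀ r, 0 ≤ g r
  zero : ∀ r, R ≤ r → g r = 0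
  ae : ∀ᵐ x ∂(volume.restrict (B N R)), f x = g ‖x‖
  integrableOn : IntegrableOn f (B N R)

/-- Taking the positive part and extending by zero makes the profile nonnegative everywhere and
nonincreasing on the whole half-line, without changing it almost everywhere on the ball. -/
theorem exists_isProfile (hN : 2 ≤ N) (hf : IntegrableOn f (B N R))
    (hf0 : ∀ᵐ x ∂(volume.restrict (B N R)), 0 ≤ f x) (hfr : IsRadiallyDecreasing R f) :
    ∃ g, IsProfile R f g := by
  obtain ⟨g, hg, hfg⟩ := hfr
  refine ⟨fun r => if r < R then max (g r) 0 else 0, ?_, fun r => ?_, fun r hr => ?_, ?_, hf⟩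
  · intro r hr s hs hrs
    dsimp only
    split_ifs with h1 h2 h2
    · exact max_le_max_right _ (hg ⟨hr, h2⟩ ⟨hs, h1⟩ hrs)
    · linarith
    · exact le_max_right _ _
    · exact le_rfl
  · split_ifs
    · exact le_max_right _ _
    · exact le_rfl
  · simp [not_lt.2 hr]
  · filter_upwards [hfg, hf0, ae_restrict_ball_mem hN] with x h1 h2 h3
    have : ‖x‖ < R := by simpa using h3.1
    rw [if_pos this, ← h1, max_eq_left h2]

namespace IsProfile

variable (h : IsProfile R f g)
include h

theorem lt_of_pos {r : ℝ} (hr : 0 < g r) : r < R := by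
  by_contra! h'
  exact hr.ne' (h.zero r h')

theorem distribution_eq (τ : ℝ≥0∞) :
    distribution (B N R) f τ = volume {x ∈ B N R | τ < ENNReal.ofReal (g ‖x‖)} := by
  refine measure_congr ?_
  have := (ae_restrict_iff' measurableSet_ball).1 h.ae
  filter_upwards [this] with x hx
  refine propext (and_congr_right fun hxB => ?_)
  rw [hx hxB, ← ofReal_norm, Real.norm_of_nonneg (h.nonneg _)]

/-- The set {f > g(r)} lies in B_r up to a null set, which bounds f^* above. If τ < g(r), continuity
yields s > r with g(s) > τ, so {f > τ} fills the larger ball B_s and τ is not admissible. At a jump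
g(r) may differ from the value of f^*. -/
theorem rearrangement_eq (hN : 2 ≤ N) {r : ℝ} (hr : 0 < r) (hc : ContinuousWithinAt g (Ioi 0) r) :
    rearrangement (B N R) f (C N * r ^ N) = ENNReal.ofReal (g r) := by
  have hC := C_pos N
  apply le_antisymm
  · refine sInf_le ?_
    rw [mem_ofPred_eq, h.distribution_eq, ← volume_ball_eq hr]
    refine measure_mono fun x hx => ?_
    rw [mem_ball_zero_iff]
    by_contra! hrx
    exact absurd hx.2 (not_lt.2 (ENNReal.ofReal_le_ofReal
      (h.antitone hr (hr.trans_le hrx) hrx)))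
  · refine le_sInf fun τ hτ => ?_
    by_contra! hlt
    rw [mem_ofPred_eq, h.distribution_eq] at hτ
    have hc' : ContinuousAt g r := hc.continuousAt (Ioi_mem_nhds hr)
    have h1 : ∀ᶠ s in 𝓝 r, τ < ENNReal.ofReal (g s) :=
      ((ENNReal.continuous_ofReal.tendsto _).comp hc').eventually (lt_mem_nhds hlt)
    obtain ⟨s, hs1, hs2⟩ := ((h1.filter_mono nhdsWithin_le_nhds).and
      (self_mem_nhdsWithin : ∀ᶠ s in 𝓝[>] r, s ∈ Ioi r)).exists
    have hs0 : 0 < s := hr.trans hs2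
    have hsR : s < R := h.lt_of_pos (ENNReal.ofReal_pos.1 (zero_le.trans_lt hs1))
    have hsub : B N s \ {0} ⊆ {x ∈ B N R | τ < ENNReal.ofReal (g ‖x‖)} := by
      rintro x ⟨hx1, hx2⟩
      have hxs : ‖x‖ < s := by simpa using hx1
      exact ⟨Metric.ball_subset_ball hsR.le hx1, hs1.trans_le (ENNReal.ofReal_le_ofReal
        (h.antitone (norm_pos_iff.2 hx2) hs0 hxs.le))⟩
    have := nontrivial_E hN
    have h2 := (measure_mono hsub).trans hτ
    rw [measure_sdiff_null (measure_singleton _), volume_ball_eq hs0,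
      ENNReal.ofReal_le_ofReal_iff (by positivity)] at h2
    have : r ^ N < s ^ N := pow_lt_pow_left₀ hs2 hr.le (by omega)
    nlinarith

/-- A monotone function has only countably many discontinuities. -/
theorem ae_rearrangement_eq (hN : 2 ≤ N) : ∀ᵐ r ∂(volume.restrict (Ioi (0 : ℝ))),
    rearrangement (B N R) f (C N * r ^ N) = ENNReal.ofReal (g r) := by
  have h1 := h.antitone.countable_not_continuousWithinAt.ae_notMem
    (volume.restrict (Ioi (0 : ℝ)))
  filter_upwards [h1, ae_restrict_mem measurableSet_Ioi] with r hr1 hr2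
  refine h.rearrangement_eq hN hr2 ?_
  by_contra hc
  exact hr1 ⟨hr2, hc⟩

theorem integrable_norm : Integrable fun x : E N => g ‖x‖ := by
  rw [← integrableOn_iff_integrable_of_support_subset (s := B N R)]
  · exact h.integrableOn.congr h.ae
  · intro x hx
    by_contra hxB
    exact hx (h.zero _ (by simpa using hxB))

theorem integrableOn_pow_mul (hN : 2 ≤ N) : IntegrableOn (fun r => r ^ (N - 1) * g r) (Ioi 0) := by
  have := nontrivial_E hN
  have h1 := (integrable_fun_norm_addHaar (volume : Measure (E N)) (f := g)).1 (h.integrable_norm)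
  simpa using h1

theorem intervalIntegrable (hN : 2 ≤ N) {a b : ℝ} (ha : 0 ≤ a) (hb : 0 ≤ b) :
    IntervalIntegrable (fun r => r ^ (N - 1) * g r) volume a b := by
  refine ⟨(h.integrableOn_pow_mul hN).mono_set fun r hr => ?_,
    (h.integrableOn_pow_mul hN).mono_set fun r hr => ?_⟩
  · exact ha.trans_lt hr.1
  · exact hb.trans_lt hr.1

/-- Change of variable from volume to radius; the Jacobian C_N N s^(N-1) is the derivative of the
volume of B_s. -/
theorem lintegral_rearrangement (hN : 2 ≤ N) {r : ℝ} (hr : 0 < r) :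
    ∫⁻ s in Ioo 0 (C N * r ^ N), rearrangement (B N R) f s =
      ENNReal.ofReal (C N * N * ∫ s in (0 : ℝ)..r, s ^ (N - 1) * g s) := by
  have hC := C_pos N
  have hN0 : N ≠ 0 := by omega
  have himage : (fun s => C N * s ^ N) '' Ioo 0 r = Ioo 0 (C N * r ^ N) := by
    ext t
    constructor
    · rintro ⟨s, hs, rfl⟩
      have := hs.1
      have : s ^ N < r ^ N := pow_lt_pow_left₀ hs.2 hs.1.le hN0
      exact ⟨by positivity, by dsimp only; gcongr⟩
    · rintro ⟨ht0, ht⟩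
      have h1 : 0 < t / C N := by positivity
      have h2 : ((t / C N) ^ ((N : ℝ)⁻¹)) ^ N = t / C N := Real.rpow_inv_natCast_pow h1.le hN0
      refine ⟨(t / C N) ^ ((N : ℝ)⁻¹), ⟨by positivity, ?_⟩, ?_⟩
      · refine lt_of_pow_lt_pow_left₀ N hr.le ?_
        rw [h2, div_lt_iff₀ hC]
        linarith
      · dsimp only
        rw [h2]
        field_simp
  rw [← himage, lintegral_image_eq_lintegral_abs_deriv_mul measurableSet_Ioo
    (f' := fun s => C N * (N * s ^ (N - 1)))
    (fun s _ => ((hasDerivAt_pow N s).const_mul (C N)).hasDerivWithinAt)]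
  · rw [intervalIntegral.integral_of_le hr.le, integral_Ioc_eq_integral_Ioo,
      ← integral_const_mul, ofReal_integral_eq_lintegral_ofReal]
    · refine lintegral_congr_ae ?_
      filter_upwards [ae_restrict_mem measurableSet_Ioo,
        ae_restrict_of_ae_restrict_of_subset Ioo_subset_Ioi_self (h.ae_rearrangement_eq hN)]
        with s hs1 hs2
      have := hs1.1
      rw [hs2, abs_of_nonneg (by positivity), ← ENNReal.ofReal_mul (by positivity)]
      ring_nf
    · exact ((h.integrableOn_pow_mul hN).mono_set Ioo_subset_Ioi_self).const_mul _
    · filter_upwards [ae_restrict_mem measurableSet_Ioo] with s hs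
      have := hs.1
      have := h.nonneg s
      positivity
  · intro s hs t ht hst
    have : s ^ N = t ^ N := mul_left_cancel₀ hC.ne' hst
    exact (pow_left_inj₀ hs.1.le ht.1.le hN0).1 this

theorem maximalFunction_eq (hN : 2 ≤ N) {r : ℝ} (hr : 0 < r) :
    maximalFunction (B N R) f (C N * r ^ N) =
      ENNReal.ofReal (N * (∫ s in (0 : ℝ)..r, s ^ (N - 1) * g s) / r ^ N) := by
  have hC := C_pos N
  rw [maximalFunction, h.lintegral_rearrangement hN hr, ← ENNReal.ofReal_div_of_pos (by positivity)]
  congr 1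
  field_simp

theorem primitive_nonneg {r : ℝ} (hr : 0 ≤ r) : 0 ≤ ∫ s in (0 : ℝ)..r, s ^ (N - 1) * g s :=
  intervalIntegral.integral_nonneg hr fun s hs => mul_nonneg (pow_nonneg hs.1 _) (h.nonneg s)

theorem toReal_maximalFunction (hN : 2 ≤ N) {r : ℝ} (hr : 0 < r) :
    (maximalFunction (B N R) f (C N * r ^ N)).toReal =
      N * (∫ s in (0 : ℝ)..r, s ^ (N - 1) * g s) / r ^ N := by
  rw [h.maximalFunction_eq hN hr, ENNReal.toReal_ofReal]
  have := h.primitive_nonneg (N := N) hr.le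
  positivity

omit h in
theorem exists_eq_C_mul_pow (hN : 2 ≤ N) {t : ℝ} (ht : 0 < t) :
    ∃ r, 0 < r ∧ C N * r ^ N = t := by
  have hC := C_pos N
  refine ⟨(t / C N) ^ ((N : ℝ)⁻¹), by positivity, ?_⟩
  rw [Real.rpow_inv_natCast_pow (by positivity) (by omega)]
  field_simp

theorem maximalFunction_lt_top (hN : 2 ≤ N) {t : ℝ} (ht : 0 < t) :
    maximalFunction (B N R) f t < ⊤ := by
  obtain ⟨r, hr, rfl⟩ := exists_eq_C_mul_pow hN ht
  rw [h.maximalFunction_eq hN hr]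
  exact ENNReal.ofReal_lt_top

theorem continuousOn_primitive (hN : 2 ≤ N) :
    ContinuousOn (fun r => ∫ s in (0 : ℝ)..r, s ^ (N - 1) * g s) (Ici 0) := by
  intro r hr
  have h1 : ContinuousOn (fun r => ∫ s in (0 : ℝ)..r, s ^ (N - 1) * g s) (uIcc 0 (r + 1)) :=
    intervalIntegral.continuousOn_primitive_interval'
      (h.intervalIntegrable hN le_rfl (by linarith [mem_Ici.1 hr])) left_mem_uIcc
  rw [uIcc_of_le (by linarith [mem_Ici.1 hr])] at h1
  refine (h1 r ⟨hr, by linarith⟩).mono_of_mem_nhdsWithin ?_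
  filter_upwards [self_mem_nhdsWithin, mem_nhdsWithin_of_mem_nhds (Iio_mem_nhds (lt_add_one r))]
    with s hs1 hs2 using ⟨hs1, le_of_lt hs2⟩

theorem z_eq (hN : 2 ≤ N) {x : E N} (hx : x ≠ 0) :
    z R f x = -(((∫ s in (0 : ℝ)..‖x‖, s ^ (N - 1) * g s) / ‖x‖ ^ N) • x) := by
  have hN0 : (N : ℝ) ≠ 0 := by positivity
  rw [z, h.toReal_maximalFunction hN (norm_pos_iff.2 hx)]
  congr 2
  field_simp

theorem continuousOn_z (hN : 2 ≤ N) : ContinuousOn (z R f) {0}ᶜ := by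
  have h1 : ContinuousOn (fun r => (∫ s in (0 : ℝ)..r, s ^ (N - 1) * g s) / r ^ N) (Ioi 0) :=
    ((h.continuousOn_primitive hN).mono Ioi_subset_Ici_self).div (continuous_pow N).continuousOn
      fun r hr => (pow_pos hr N).ne'
  refine ((continuousOn_comp_norm h1).smul continuousOn_id).neg.congr fun x hx => ?_
  exact h.z_eq hN hx

theorem norm_z (hN : 2 ≤ N) {x : E N} (hx : x ≠ 0) :
    ‖z R f x‖ = (∫ s in (0 : ℝ)..‖x‖, s ^ (N - 1) * g s) / ‖x‖ ^ (N - 1) := by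
  have hx' := norm_pos_iff.2 hx
  have := h.primitive_nonneg (N := N) hx'.le
  rw [h.z_eq hN hx, norm_neg, norm_smul, Real.norm_of_nonneg (by positivity)]
  obtain ⟨n, rfl⟩ : ∃ n, N = n + 1 := ⟨N - 1, by omega⟩
  rw [Nat.add_sub_cancel]
  field_simp
  ring

/-- In polar coordinates the weight r^(N-1) cancels the denominator of |z|, leaving the primitive of
r^(N-1) g, which is continuous up to r = 0. -/
theorem integrableOn_z (hN : 2 ≤ N) : IntegrableOn (z R f) (B N R) := by
  have := nontrivial_E hN
  have hmem := ae_restrict_ball_mem (N := N) (R := R) hN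
  have h1 : IntegrableOn (fun x : E N => (fun r => (∫ s in (0 : ℝ)..r, s ^ (N - 1) * g s) /
      r ^ (N - 1)) ‖x‖) (B N R) := by
    refine (integrableOn_fun_norm_addHaar (volume : Measure (E N))
      (f := fun r => (∫ s in (0 : ℝ)..r, s ^ (N - 1) * g s) / r ^ (N - 1)) (r := R)).2 ?_
    have h2 : IntegrableOn (fun r => ∫ s in (0 : ℝ)..r, s ^ (N - 1) * g s) (Ioo 0 R) :=
      (((h.continuousOn_primitive hN).mono Icc_subset_Ici_self).integrableOn_Icc (b := R)).mono_set
        Ioo_subset_Icc_self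
    refine h2.congr_fun (fun r hr => ?_) measurableSet_Ioo
    have := hr.1
    simp only [finrank_euclideanSpace, Fintype.card_fin, smul_eq_mul]
    field_simp
  refine Integrable.mono' h1 (aestronglyMeasurable_of_continuousOn_compl_zero
    (h.continuousOn_z hN) (hmem.mono fun _ h => h.2)) (hmem.mono fun x hx => ?_)
  exact (h.norm_z hN hx.2).le

/-- Integration by parts for the primitive of the profile. -/
theorem integral_primitive_mul_deriv (hN : 2 ≤ N) (hR : 0 < R) {ψ : ℝ → ℝ} (hψ : ContDiff ℝ 1 ψ)
    (hψR : ψ R = 0) :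
    ∫ r in (0 : ℝ)..R, (∫ s in (0 : ℝ)..r, s ^ (N - 1) * g s) * deriv ψ r =
      -∫ r in (0 : ℝ)..R, r ^ (N - 1) * g r * ψ r := by
  have hi := h.intervalIntegrable hN le_rfl hR.le
  -- The profile may jump, so its primitive is absolutely continuous but need not be differentiable
  -- everywhere.
  have h1 := hi.absolutelyContinuousOnInterval_intervalIntegral (c := 0) left_mem_uIcc
  have h2 : AbsolutelyContinuousOnInterval ψ 0 R := hψ.contDiffOn.absolutelyContinuousOnInterval
  rw [h1.integral_mul_deriv_eq_deriv_mul h2, hψR, intervalIntegral.integral_same]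
  simp only [mul_zero, zero_mul, sub_zero, zero_sub, neg_inj]
  refine intervalIntegral.integral_congr_ae ?_
  filter_upwards [hi.ae_hasDerivAt_integral] with r hr hr'
  rw [(hr (uIoc_subset_uIcc hr') 0 left_mem_uIcc).deriv]

/-- Along the ray through θ, r^(N-1) ⟨z, ∇φ⟩ is -P(r) times the derivative of φ(rθ), with P' =
r^(N-1) g almost everywhere. Integration by parts on each ray, followed by integration over the
sphere, gives the claim. As P(0) = 0, no point mass arises at the origin, although φ(0) is
arbitrary. -/
theorem negDivEq_z (hN : 2 ≤ N) (hR : 0 < R) : NegDivEq R (z R f) f := by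
  intro φ hφ
  have hzi := h.integrableOn_z hN
  have hn : ∀ {θ : Metric.sphere (0 : E N) 1} {r : ℝ}, 0 < r → ‖r • (θ : E N)‖ = r := by
    intro θ r hr
    rw [norm_smul, norm_eq_of_mem_sphere θ, mul_one, Real.norm_of_nonneg hr.le]
  have hout : ∀ {θ : Metric.sphere (0 : E N) 1} {r : ℝ}, r ∈ Ioi 0 \ Ioc 0 R →
      r • (θ : E N) ∉ B N R := by
    intro θ r hr
    rw [mem_ball_zero_iff, hn hr.1]
    exact fun h' => hr.2 ⟨hr.1, h'.le⟩
  have hL : ∫ x in B N R, inner ℝ (z R f x) (gradient φ x) =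
      ∫ θ, (∫ r in (0 : ℝ)..R, r ^ (N - 1) * g r * φ (r • (θ : E N)))
        ∂(volume : Measure (E N)).toSphere := by
    have hF : Integrable fun x : E N => inner ℝ (z R f x) (gradient φ x) := by
      rw [← integrableOn_iff_integrable_of_support_subset (s := B N R)]
      · exact integrable_inner_of_memLp (p := 1) (q := ⊤) (memLp_one_iff_integrable.2 hzi)
          (hφ.memLp_gradient ⊤)
      · intro x hx
        by_contra hxB
        exact hx (by simp [hφ.gradient_eq_zero hxB])
    rw [setIntegral_eq_integral_of_forall_compl_eq_zero
      (fun x hx => by rw [hφ.gradient_eq_zero hx, inner_zero_right]),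
      integral_eq_integral_sphere hN hF]
    refine integral_congr_ae (ae_of_all _ fun θ => ?_)
    have hψ : ContDiff ℝ 1 fun r : ℝ => φ (r • (θ : E N)) :=
      (hφ.smooth.of_le (by simp)).comp (contDiff_id.smul contDiff_const)
    have hd : ∀ r : ℝ, deriv (fun r : ℝ => φ (r • (θ : E N))) r =
        inner ℝ (gradient φ (r • (θ : E N))) (θ : E N) := by
      intro r
      rw [inner_gradient_left]
      have h1 : HasDerivAt (fun r : ℝ => r • (θ : E N)) (θ : E N) r := by
        simpa using (hasDerivAt_id r).smul_const (θ : E N)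
      exact ((hφ.smooth.contDiffAt.differentiableAt (by simp)).hasFDerivAt.comp_hasDerivAt r h1).deriv
    have hψR : φ (R • (θ : E N)) = 0 := by
      refine hφ.eq_zero ?_
      rw [mem_ball_zero_iff, hn hR]
      exact lt_irrefl R
    have hbp := h.integral_primitive_mul_deriv hN hR hψ hψR
    dsimp only
    rw [← neg_inj, ← hbp, intervalIntegral.integral_of_le hR.le,
      setIntegral_eq_of_subset_of_forall_sdiff_eq_zero measurableSet_Ioi Ioc_subset_Ioi_self
        (f := fun r => r ^ (N - 1) * inner ℝ (z R f (r • (θ : E N))) (gradient φ (r • (θ : E N))))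
        (fun r hr => by rw [hφ.gradient_eq_zero (hout hr), inner_zero_right, mul_zero]),
      ← integral_neg]
    refine setIntegral_congr_fun measurableSet_Ioc fun r hr => ?_
    have hr0 := hr.1
    have hne : r • (θ : E N) ≠ 0 := by
      rw [← norm_ne_zero_iff, hn hr0]; exact hr0.ne'
    simp only [hd]
    rw [h.z_eq hN hne, hn hr0, inner_neg_left, real_inner_smul_left, real_inner_smul_left,
      real_inner_comm (θ : E N)]
    obtain ⟨n, rfl⟩ : ∃ n, N = n + 1 := ⟨N - 1, by omega⟩
    rw [Nat.add_sub_cancel]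
    field_simp
    ring
  have hRi : Integrable fun x : E N => g ‖x‖ * φ x := by
    have := integrable_inner_of_memLp (p := ⊤) (q := 1)
      (hφ.smooth.continuous.memLp_of_hasCompactSupport (μ := volume) hφ.compact)
      (memLp_one_iff_integrable.2 h.integrable_norm)
    simpa only [Real.inner_apply, mul_comm] using this
  have hRt : ∫ x in B N R, f x * φ x =
      ∫ θ, (∫ r in (0 : ℝ)..R, r ^ (N - 1) * g r * φ (r • (θ : E N)))
        ∂(volume : Measure (E N)).toSphere := by
    rw [integral_congr_ae (g := fun x => g ‖x‖ * φ x) (h.ae.mono fun x hx => by simp only [hx]),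
      setIntegral_eq_integral_of_forall_compl_eq_zero
      (fun x hx => by rw [hφ.eq_zero hx, mul_zero]),
      integral_eq_integral_sphere hN hRi]
    refine integral_congr_ae (ae_of_all _ fun θ => ?_)
    dsimp only
    rw [intervalIntegral.integral_of_le hR.le,
      setIntegral_eq_of_subset_of_forall_sdiff_eq_zero measurableSet_Ioi Ioc_subset_Ioi_self
        (f := fun r => r ^ (N - 1) * (g ‖r • (θ : E N)‖ * φ (r • (θ : E N))))
        (fun r hr => by rw [hφ.eq_zero (hout hr), mul_zero, mul_zero])]
    refine setIntegral_congr_fun measurableSet_Ioc fun r hr => ?_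
    simp only [hn hr.1]
    ring
  rw [hL, hRt]

end IsProfile

end Rearrangement

/-! ### The explicit radial function -/

section RadialSolution

variable {N : ℕ} {R p : ℝ} {f : E N → ℝ} {g : ℝ → ℝ}

/-- The radial flux `(r / N) f^{**}(C_N r^N)`. -/
def radialFlux (R : ℝ) (f : E N → ℝ) (r : ℝ) : ℝ :=
  r / N * (maximalFunction (B N R) f (C N * r ^ N)).toReal

/-- The modulus of the gradient of `radialSolution R p f` at distance `r` from the origin. -/
def radialSlope (R p : ℝ) (f : E N → ℝ) (r : ℝ) : ℝ :=
  1 + radialFlux R f r ^ (1 / (p - 1))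

/-- The integrand in the definition of `radialSolution R p f`. -/
def radialIntegrand (R p : ℝ) (f : E N → ℝ) (s : ℝ) : ℝ :=
  (1 + (s ^ (1 / (N : ℝ)) / (N * C N ^ (1 / (N : ℝ))) *
    (maximalFunction (B N R) f s).toReal) ^ (1 / (p - 1))) * s ^ (-1 + 1 / (N : ℝ))

/-- The profile of `radialSolution R p f`. -/
def radialProfile (R p : ℝ) (f : E N → ℝ) (r : ℝ) : ℝ :=
  1 / (N * C N ^ (1 / (N : ℝ))) * ∫ s in (C N * r ^ N)..(C N * R ^ N), radialIntegrand R p f s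

theorem radialSolution_eq (x : E N) : radialSolution R p f x = radialProfile R p f ‖x‖ := rfl

theorem radialProfile_self : radialProfile R p f R = 0 := by
  simp [radialProfile]

theorem C_mul_pow_rpow (hN : 2 ≤ N) {r : ℝ} (hr : 0 ≤ r) :
    (C N * r ^ N) ^ (1 / (N : ℝ)) = C N ^ (1 / (N : ℝ)) * r := by
  rw [Real.mul_rpow (C_pos N).le (by positivity), one_div,
    Real.pow_rpow_inv_natCast hr (by omega)]

theorem radialFlux_nonneg {r : ℝ} (hr : 0 ≤ r) : 0 ≤ radialFlux R f r := by
  unfold radialFlux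
  positivity

theorem one_le_radialSlope {r : ℝ} (hr : 0 ≤ r) : 1 ≤ radialSlope R p f r :=
  le_add_of_nonneg_right (Real.rpow_nonneg (radialFlux_nonneg hr) _)

/-- Under s = C_N r^N one has s^(1/N) = C_N^(1/N) r and s^(-1+1/N) ds = N C_N^(1/N) dr, which
explains both normalising constants in ũ_p. -/
theorem radialIntegrand_mul (hN : 2 ≤ N) {r : ℝ} (hr : 0 < r) :
    1 / (N * C N ^ (1 / (N : ℝ))) *
      (radialIntegrand R p f (C N * r ^ N) * (C N * (N * r ^ (N - 1)))) = radialSlope R p f r := by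
  have hC := C_pos N
  have hCN : 0 < C N ^ (1 / (N : ℝ)) := Real.rpow_pos_of_pos hC _
  have hN0 : (0 : ℝ) < N := by positivity
  have hbase : (C N * r ^ N) ^ (1 / (N : ℝ)) / (N * C N ^ (1 / (N : ℝ))) = r / N := by
    rw [C_mul_pow_rpow hN hr.le]
    field_simp
  have hpow : (C N * r ^ N) ^ (-1 + 1 / (N : ℝ)) =
      (C N * r ^ N)⁻¹ * (C N ^ (1 / (N : ℝ)) * r) := by
    rw [Real.rpow_add (by positivity), C_mul_pow_rpow hN hr.le, Real.rpow_neg_one]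
  rw [radialIntegrand, hbase, hpow, radialSlope, radialFlux]
  obtain ⟨n, rfl⟩ : ∃ n, N = n + 1 := ⟨N - 1, by omega⟩
  rw [Nat.add_sub_cancel, pow_succ]
  field_simp

theorem unitField_smul_radialFlux (x : E N) :
    -(radialFlux R f ‖x‖ • unitField x) = z R f x := by
  rcases eq_or_ne x 0 with rfl | hx
  · simp [z, unitField]
  · have := norm_ne_zero_iff.2 hx
    rw [z, radialFlux, unitField, smul_smul]
    congr 2
    field_simp

namespace IsProfile

variable (h : IsProfile R f g)
include h

theorem continuousOn_maximalFunction (hN : 2 ≤ N) :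
    ContinuousOn (fun t => (maximalFunction (B N R) f t).toReal) (Ioi 0) := by
  have hC := C_pos N
  have h1 : ContinuousOn (fun r => N * (∫ s in (0 : ℝ)..r, s ^ (N - 1) * g s) / r ^ N) (Ioi 0) :=
    (continuousOn_const.mul ((h.continuousOn_primitive hN).mono Ioi_subset_Ici_self)).div
      (continuous_pow N).continuousOn fun r hr => (pow_pos hr N).ne'
  have h2 : ContinuousOn (fun t => (t / C N) ^ ((N : ℝ)⁻¹)) (Ioi 0) :=
    (continuous_id.div_const _).continuousOn.rpow_const fun _ _ => Or.inr (by positivity)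
  have hmaps : MapsTo (fun t => (t / C N) ^ ((N : ℝ)⁻¹)) (Ioi 0) (Ioi 0) := fun t ht => by
    have : 0 < t := ht
    exact Real.rpow_pos_of_pos (by positivity) _
  refine (h1.comp h2 hmaps).congr fun t ht => ?_
  have h3 := h.toReal_maximalFunction hN (hmaps ht)
  have h4 : C N * ((t / C N) ^ ((N : ℝ)⁻¹)) ^ N = t := by
    have : 0 < t := ht
    rw [Real.rpow_inv_natCast_pow (by positivity) (by omega)]
    field_simp
  rw [h4] at h3
  exact h3

theorem continuousOn_radialFlux (hN : 2 ≤ N) :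
    ContinuousOn (radialFlux R f) (Ioi 0) := by
  have hC := C_pos N
  refine (continuous_id.div_const _).continuousOn.mul
    ((h.continuousOn_maximalFunction hN).comp (by fun_prop) fun r hr => ?_)
  have : 0 < r := hr
  exact mul_pos hC (pow_pos this N)

theorem continuousOn_radialSlope (hN : 2 ≤ N) (hp : 1 < p) :
    ContinuousOn (radialSlope R p f) (Ioi 0) :=
  continuousOn_const.add ((h.continuousOn_radialFlux hN).rpow_const fun _ _ =>
    Or.inr (one_div_nonneg.2 (by linarith)))

theorem continuousOn_radialIntegrand (hN : 2 ≤ N) (hp : 1 < p) :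
    ContinuousOn (radialIntegrand R p f) (Ioi 0) := by
  refine (continuousOn_const.add (ContinuousOn.rpow_const (ContinuousOn.mul ?_
    (h.continuousOn_maximalFunction hN)) fun _ _ => Or.inr (one_div_nonneg.2 (by linarith)))).mul
    (continuousOn_id.rpow_const fun s hs => Or.inl (ne_of_gt hs))
  exact (continuousOn_id.rpow_const fun _ _ => Or.inr (by positivity)).div_const _

theorem hasDerivAt_radialProfile (hN : 2 ≤ N) (hR : 0 < R) (hp : 1 < p) {r : ℝ} (hr : 0 < r) :
    HasDerivAt (radialProfile R p f) (-radialSlope R p f r) r := by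
  have hC := C_pos N
  have hc := h.continuousOn_radialIntegrand hN hp
  have ha : 0 < C N * r ^ N := by positivity
  have hb : 0 < C N * R ^ N := by positivity
  have hsub : uIcc (C N * r ^ N) (C N * R ^ N) ⊆ Ioi 0 := fun s hs =>
    lt_of_lt_of_le (lt_min ha hb) hs.1
  have h1 := intervalIntegral.integral_hasDerivAt_left ((hc.mono hsub).intervalIntegrable)
    (hc.stronglyMeasurableAtFilter isOpen_Ioi _ ha) (hc.continuousAt (Ioi_mem_nhds ha))
  have h2 : HasDerivAt (fun r : ℝ => C N * r ^ N) (C N * (N * r ^ (N - 1))) r :=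
    (hasDerivAt_pow N r).const_mul (C N)
  have h3 := (h1.comp r h2).const_mul (1 / (N * C N ^ (1 / (N : ℝ))))
  rw [← radialIntegrand_mul hN hr, ← mul_neg, ← neg_mul]
  exact h3

theorem hasGradientAt_radialSolution (hN : 2 ≤ N) (hR : 0 < R) (hp : 1 < p) {x : E N}
    (hx : x ≠ 0) :
    HasGradientAt (radialSolution R p f) (-(radialSlope R p f ‖x‖ • unitField x)) x := by
  have := hasGradientAt_comp_norm hx (h.hasDerivAt_radialProfile hN hR hp (norm_pos_iff.2 hx))
  rwa [neg_smul] at this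

theorem gradient_radialSolution (hN : 2 ≤ N) (hR : 0 < R) (hp : 1 < p) {x : E N} (hx : x ≠ 0) :
    gradient (radialSolution R p f) x = -(radialSlope R p f ‖x‖ • unitField x) :=
  (h.hasGradientAt_radialSolution hN hR hp hx).gradient

theorem continuousOn_radialSolution (hN : 2 ≤ N) (hR : 0 < R) (hp : 1 < p) :
    ContinuousOn (radialSolution R p f : E N → ℝ) {0}ᶜ := fun _ hx =>
  (h.hasGradientAt_radialSolution hN hR hp hx).differentiableAt.continuousAt.continuousWithinAt

theorem H_gradient_radialSolution (hN : 2 ≤ N) (hR : 0 < R) (hp : 1 < p) {x : E N} (hx : x ≠ 0) :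
    H (p - 1) (gradient (radialSolution R p f) x) = z R f x := by
  rw [h.gradient_radialSolution hN hR hp hx, radialSlope,
    H_neg_smul (by linarith) (radialFlux_nonneg (norm_nonneg x)) (norm_unitField hx),
    unitField_smul_radialFlux]

theorem norm_gradient_radialSolution (hN : 2 ≤ N) (hR : 0 < R) (hp : 1 < p) {x : E N}
    (hx : x ≠ 0) : ‖gradient (radialSolution R p f) x‖ = radialSlope R p f ‖x‖ := by
  rw [h.gradient_radialSolution hN hR hp hx, norm_neg, norm_smul, norm_unitField hx, mul_one,
    Real.norm_of_nonneg (zero_le_one.trans (one_le_radialSlope (norm_nonneg x)))]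

theorem negDivEq_H_gradient_radialSolution (hN : 2 ≤ N) (hR : 0 < R) (hp : 1 < p) :
    NegDivEq R (fun x => H (p - 1) (gradient (radialSolution R p f) x)) f := by
  intro φ hφ
  rw [← h.negDivEq_z hN hR φ hφ]
  refine integral_congr_ae ((ae_restrict_ball_mem hN).mono fun x hx => ?_)
  simp only [h.H_gradient_radialSolution hN hR hp hx.2]

theorem isWeakSolution_radialSolution (hN : 2 ≤ N) (hR : 0 < R) (hp : 1 < p)
    (hG : MemLp (gradient (radialSolution R p f)) (ENNReal.ofReal p) (volume.restrict (B N R))) :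
    IsWeakSolution R p f (radialSolution R p f) (gradient (radialSolution R p f)) := by
  refine ⟨?_, h.negDivEq_H_gradient_radialSolution hN hR hp⟩
  have hmem := ae_restrict_ball_mem (N := N) (R := R) hN
  refine memSobolevZero_radial hN hR hp (w := fun r => -radialSlope R p f r)
    (h.continuousOn_radialSlope hN hp).neg
    (fun r hr => h.hasDerivAt_radialProfile hN hR hp hr) radialProfile_self ?_ ?_
  -- The radial derivative of ũ_p is minus the modulus of its gradient.
  · refine (memLp_congr_ae ?_).1 hG.norm.neg
    filter_upwards [hmem] with x hx
    simp [h.norm_gradient_radialSolution hN hR hp hx.2]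
  · filter_upwards [hmem] with x hx
    rw [h.gradient_radialSolution hN hR hp hx.2, neg_smul]

theorem memLp_gradient_of_memLp_flux (hN : 2 ≤ N) (hR : 0 < R) (hp : 1 < p)
    (hA : MemLp (fun x : E N => radialFlux R f ‖x‖ ^ (1 / (p - 1))) (ENNReal.ofReal p)
      (volume.restrict (B N R))) :
    MemLp (gradient (radialSolution R p f)) (ENNReal.ofReal p) (volume.restrict (B N R)) := by
  have := isFiniteMeasure_restrict_ball (N := N) (R := R)
  have hmem := ae_restrict_ball_mem (N := N) (R := R) hN
  have hq : MemLp (fun x : E N => radialSlope R p f ‖x‖) (ENNReal.ofReal p)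
      (volume.restrict (B N R)) := (memLp_const (1 : ℝ)).add hA
  have hF : MemLp (fun x : E N => -(radialSlope R p f ‖x‖ • unitField x)) (ENNReal.ofReal p)
      (volume.restrict (B N R)) :=
    (hq.of_le (hq.1.smul measurable_unitField.aestronglyMeasurable)
      (ae_of_all _ fun x => norm_smul_unitField_le _ _)).neg
  refine (memLp_congr_ae ?_).2 hF
  filter_upwards [hmem] with x hx using h.gradient_radialSolution hN hR hp hx.2

/-- At t = C_N r^N the flux is t^(1/N) f^{**}(t) up to a constant, so the Lorentz bound makes it
bounded, and the ball has finite measure. -/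
theorem memLp_gradient_of_weakLorentzNorm (hN : 2 ≤ N) (hR : 0 < R) (hp : 1 < p)
    (hK : weakLorentzNorm (B N R) N f < ⊤) :
    MemLp (gradient (radialSolution R p f)) (ENNReal.ofReal p) (volume.restrict (B N R)) := by
  have := isFiniteMeasure_restrict_ball (N := N) (R := R)
  have hmem := ae_restrict_ball_mem (N := N) (R := R) hN
  have hC := C_pos N
  have hCN : 0 < C N ^ (1 / (N : ℝ)) := Real.rpow_pos_of_pos hC _
  have hN0 : (0 : ℝ) < N := by positivity
  have hp1 : 0 ≤ 1 / (p - 1) := one_div_nonneg.2 (by linarith)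
  set K := weakLorentzNorm (B N R) N f with hKdef
  have hb : ∀ r, 0 < r → radialFlux R f r ≤ K.toReal / (N * C N ^ (1 / (N : ℝ))) := by
    intro r hr
    have ht : 0 < C N * r ^ N := by positivity
    have h1 : ENNReal.ofReal ((C N * r ^ N) ^ (1 / (N : ℝ))) *
        maximalFunction (B N R) f (C N * r ^ N) ≤ K :=
      le_iSup (fun t : Ioi (0 : ℝ) => ENNReal.ofReal ((t : ℝ) ^ (1 / (N : ℝ))) *
        maximalFunction (B N R) f t) ⟨_, ht⟩
    have h2 := ENNReal.toReal_mono hK.ne h1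
    rw [ENNReal.toReal_mul, ENNReal.toReal_ofReal (by positivity), C_mul_pow_rpow hN hr.le] at h2
    rw [radialFlux, le_div_iff₀ (by positivity)]
    calc _ = C N ^ (1 / (N : ℝ)) * r * (maximalFunction (B N R) f (C N * r ^ N)).toReal := by
          field_simp
      _ ≤ _ := h2
  refine h.memLp_gradient_of_memLp_flux hN hR hp (MemLp.of_bound ?_
    ((K.toReal / (N * C N ^ (1 / (N : ℝ)))) ^ (1 / (p - 1))) ?_)
  · refine aestronglyMeasurable_of_continuousOn_compl_zero (continuousOn_comp_norm
      (w := fun r => radialFlux R f r ^ (1 / (p - 1)))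
      ((h.continuousOn_radialFlux hN).rpow_const fun _ _ => Or.inr hp1)) (hmem.mono fun _ h => h.2)
  · filter_upwards [hmem] with x hx
    have hx0 := norm_pos_iff.2 hx.2
    have h0 := radialFlux_nonneg (R := R) (f := f) hx0.le
    rw [Real.norm_of_nonneg (Real.rpow_nonneg h0 _)]
    exact Real.rpow_le_rpow h0 (hb _ hx0) hp1

end IsProfile

end RadialSolution

/-! ### Weak solutions -/

section Solutions

variable {N : ℕ} {R p : ℝ} {f : E N → ℝ} {g : ℝ → ℝ}

/-- Two weak solutions have the same flux. -/
theorem IsWeakSolution.H_ae_eq (hp : 1 < p) {u₁ u₂ : E N → ℝ} {G₁ G₂ : E N → E N}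
    (h₁ : IsWeakSolution R p f u₁ G₁) (h₂ : IsWeakSolution R p f u₂ G₂) :
    ∀ᵐ x ∂(volume.restrict (B N R)), H (p - 1) (G₁ x) = H (p - 1) (G₂ x) := by
  have := holderConjugate_ofReal hp
  have hG₁ := h₁.memSobolevZero.memLp_grad
  have hG₂ := h₂.memSobolevZero.memLp_grad
  have hH₁ := memLp_H hp hG₁
  have hH₂ := memLp_H hp hG₂
  have hD : MemLp (fun x => H (p - 1) (G₁ x) - H (p - 1) (G₂ x)) (ENNReal.ofReal (p / (p - 1)))
      (volume.restrict (B N R)) := hH₁.sub hH₂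
  -- The difference of the fluxes annihilates gradients of test functions, hence by density the
  -- gradients of all of W_0^{1,p}, in particular those of both solutions.
  have hzero : ∀ {u : E N → ℝ} {G : E N → E N}, MemSobolevZero R p u G →
      ∫ x in B N R, inner ℝ (H (p - 1) (G₁ x) - H (p - 1) (G₂ x)) (G x) = 0 := by
    intro u G hu
    obtain ⟨φ, hφ, -, hφG⟩ := hu.approx
    refine tendsto_nhds_unique (tendsto_integral_inner hD hu.memLp_grad
      (fun n => (hφ n).memLp_gradient _) hφG) (tendsto_const_nhds.congr fun n => ?_)
    have e1 := h₁.equation (φ n) (hφ n)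
    have e2 := h₂.equation (φ n) (hφ n)
    simp only [inner_sub_left]
    rw [integral_sub
      (integrable_inner_of_memLp hH₁ ((hφ n).memLp_gradient (ENNReal.ofReal p)))
      (integrable_inner_of_memLp hH₂ ((hφ n).memLp_gradient (ENNReal.ofReal p))), e1, e2, sub_self]
  have hint : ∫ x in B N R, inner ℝ (H (p - 1) (G₁ x) - H (p - 1) (G₂ x)) (G₁ x - G₂ x) = 0 := by
    simp only [inner_sub_right]
    rw [integral_sub (integrable_inner_of_memLp hD hG₁) (integrable_inner_of_memLp hD hG₂),
      hzero h₁.memSobolevZero, hzero h₂.memSobolevZero, sub_self]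
  have hae := (integral_eq_zero_iff_of_nonneg
    (fun x => inner_H_sub_H_sub_nonneg (by linarith) (G₁ x) (G₂ x))
    (integrable_inner_of_memLp hD (hG₁.sub hG₂))).1 hint
  filter_upwards [hae] with x hx using H_eq_H_of_inner_eq_zero (by linarith) hx

namespace IsProfile

variable (h : IsProfile R f g)
include h

/-- A field with divergence `-f` dominates the radial one in the dual norm,
away from the origin. -/
theorem setIntegral_flux_rpow_le (hN : 2 ≤ N) (hR : 0 < R) (hp : 1 < p) {F : E N → E N}
    (hF : MemLp F (ENNReal.ofReal (p / (p - 1))) (volume.restrict (B N R)))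
    (hdiv : NegDivEq R F f) {ε : ℝ} (hε : 0 < ε) :
    ∫ x in B N R ∩ {x | ε < ‖x‖}, radialFlux R f ‖x‖ ^ (p / (p - 1)) ≤
      ∫ x in B N R, ‖F x‖ ^ (p / (p - 1)) := by
  have hp0 : 0 < p := by linarith
  have hpm : 0 < p - 1 := by linarith
  have hconj : p.HolderConjugate (p / (p - 1)) :=
    (Real.holderConjugate_iff_eq_conjExponent hp).2 rfl
  have := holderConjugate_ofReal hp
  have hfinB := isFiniteMeasure_restrict_ball (N := N) (R := R)
  -- On this annulus every nonnegative power of the flux is bounded, which keeps finite all the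
  -- integrals below; integrability near the origin is what remains to be proved.
  set S : Set (E N) := B N R ∩ {x | ε < ‖x‖} with hS
  have hSm : MeasurableSet S := measurableSet_ball.inter (measurableSet_lt measurable_const
    measurable_norm)
  have hSB : S ⊆ B N R := inter_subset_left
  set μ := volume.restrict S with hμ
  have hμle : μ ≤ volume.restrict (B N R) := Measure.restrict_mono_set _ hSB
  have hfin : IsFiniteMeasure μ := isFiniteMeasure_of_le _ hμle
  have hmem : ∀ᵐ x ∂μ, ‖x‖ ∈ Ioo ε R := by
    filter_upwards [ae_restrict_mem hSm] with x hx using ⟨hx.2, by simpa using hx.1⟩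
  have hne : ∀ᵐ x ∂μ, x ≠ 0 := hmem.mono fun x hx => norm_pos_iff.1 (hε.trans hx.1)
  have hA0 : ∀ x : E N, 0 ≤ radialFlux R f ‖x‖ := fun x => radialFlux_nonneg (norm_nonneg x)
  -- powers of the flux are bounded away from the origin
  have hpowc : ∀ {q : ℝ}, 0 ≤ q → ContinuousOn (fun r => radialFlux R f r ^ q) (Ioi 0) :=
    fun hq => (h.continuousOn_radialFlux hN).rpow_const fun _ _ => Or.inr hq
  have hpow : ∀ {q : ℝ} (s : ℝ≥0∞), 0 ≤ q →
      MemLp (fun x : E N => radialFlux R f ‖x‖ ^ q) s μ := by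
    intro q s hq
    obtain ⟨K, hK⟩ := isCompact_Icc.exists_bound_of_continuousOn
      ((hpowc hq).mono fun r (hr : r ∈ Icc ε R) => hε.trans_le hr.1)
    refine MemLp.of_bound (aestronglyMeasurable_of_continuousOn_compl_zero
      (continuousOn_comp_norm (hpowc hq)) hne) K ?_
    filter_upwards [hmem] with x hx using hK _ ⟨hx.1.le, hx.2.le⟩
  have hq1 : 0 ≤ 1 / (p - 1) := by positivity
  -- Supports in (ε, R) make the gradients of the radial primitives vanish off the annulus, so
  -- integrals over the ball and over the annulus agree when testing.
  obtain ⟨η, hηd, hηs, hηl⟩ := exists_radial_tendsto hp.le hmem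
    (hpow (ENNReal.ofReal p) hq1) (aestronglyMeasurable_map_norm (hpowc hq1) hne)
  have hηs' : ∀ n, tsupport (η n) ⊆ Ioo 0 R := fun n =>
    (hηs n).trans (Ioo_subset_Ioo_left hε.le)
  have hgrad : ∀ n x, gradient (radialPrimitive N R (η n)) x = η n ‖x‖ • unitField x :=
    fun n x => (hasGradientAt_radialPrimitive (hηd n).continuous (hηs' n) x).gradient
  have htest := fun n => isTestFunction_radialPrimitive (N := N) (hηd n) (hηs' n)
  have hrestrict : ∀ (V : E N → E N) n,
      ∫ x in B N R, inner ℝ (V x) (gradient (radialPrimitive N R (η n)) x) =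
        ∫ x, inner ℝ (V x) (gradient (radialPrimitive N R (η n)) x) ∂μ := by
    intro V n
    refine setIntegral_eq_of_subset_of_forall_sdiff_eq_zero measurableSet_ball hSB fun x hx => ?_
    have : η n ‖x‖ = 0 := image_eq_zero_of_notMem_tsupport fun h' =>
      hx.2 ⟨hx.1, (hηs n h').1⟩
    rw [hgrad, this, zero_smul, inner_zero_right]
  have hFS : MemLp F (ENNReal.ofReal (p / (p - 1))) μ := hF.mono_measure hμle
  have hzS : MemLp (z R f) (ENNReal.ofReal (p / (p - 1))) μ := by
    have h1 := hpow (q := 1) (ENNReal.ofReal (p / (p - 1))) zero_le_one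
    simp only [Real.rpow_one] at h1
    have h2 := (h1.of_le (h1.1.smul measurable_unitField.aestronglyMeasurable)
      (ae_of_all _ fun x => norm_smul_unitField_le _ _)).neg
    exact (memLp_congr_ae (ae_of_all _ fun x => unitField_smul_radialFlux x)).1 h2
  -- This field realises equality in Young's inequality against -z: ⟨-z, w⟩ = |z|^(p') = |w|^p
  -- almost everywhere on the annulus.
  set w : E N → E N := fun x => radialFlux R f ‖x‖ ^ (1 / (p - 1)) • unitField x with hw
  have hwm : MemLp w (ENNReal.ofReal p) μ := by
    have h1 := hpow (ENNReal.ofReal p) hq1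
    exact h1.of_le (h1.1.smul measurable_unitField.aestronglyMeasurable)
      (ae_of_all _ fun x => norm_smul_unitField_le _ _)
  have hlim : Tendsto (fun n => eLpNorm (fun x => gradient (radialPrimitive N R (η n)) x - w x)
      (ENNReal.ofReal p) μ) atTop (𝓝 0) := by
    refine tendsto_of_tendsto_of_tendsto_of_le_of_le tendsto_const_nhds hηl (fun _ => zero_le)
      fun n => eLpNorm_mono_ae (ae_of_all _ fun x => ?_)
    rw [hgrad, hw, ← sub_smul]
    exact norm_smul_unitField_le _ _
  have hgm : ∀ n, MemLp (gradient (radialPrimitive N R (η n))) (ENNReal.ofReal p) μ :=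
    fun n => ((htest n).memLp_gradient _).mono_measure hμle
  have heq : ∫ x, inner ℝ (F x) (w x) ∂μ = ∫ x, inner ℝ (z R f x) (w x) ∂μ := by
    refine tendsto_nhds_unique (tendsto_integral_inner hFS hwm hgm hlim)
      ((tendsto_integral_inner hzS hwm hgm hlim).congr fun n => ?_)
    rw [← hrestrict, ← hrestrict, hdiv _ (htest n), h.negDivEq_z hN hR _ (htest n)]
  have hzw : ∀ᵐ x ∂μ, inner ℝ (z R f x) (w x) = -radialFlux R f ‖x‖ ^ (p / (p - 1)) := by
    filter_upwards [hne] with x hx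
    rw [← unitField_smul_radialFlux, hw, inner_neg_left, real_inner_smul_left,
      real_inner_smul_right, real_inner_self_eq_norm_sq, norm_unitField hx, one_pow, mul_one,
      show p / (p - 1) = 1 + 1 / (p - 1) by field_simp; ring,
      Real.rpow_add' (hA0 x) (by positivity), Real.rpow_one]
  rw [integral_congr_ae hzw, integral_neg] at heq
  have hFpS : Integrable (fun x => ‖F x‖ ^ (p / (p - 1))) μ := by
    have := hFS.integrable_norm_rpow (by simpa using div_pos hp0 hpm) ENNReal.ofReal_ne_top
    rwa [ENNReal.toReal_ofReal (by positivity)] at this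
  have hFpB : Integrable (fun x => ‖F x‖ ^ (p / (p - 1))) (volume.restrict (B N R)) := by
    have := hF.integrable_norm_rpow (by simpa using div_pos hp0 hpm) ENNReal.ofReal_ne_top
    rwa [ENNReal.toReal_ofReal (by positivity)] at this
  have hAi : Integrable (fun x : E N => radialFlux R f ‖x‖ ^ (p / (p - 1))) μ :=
    memLp_one_iff_integrable.1 (hpow 1 (by positivity))
  -- With I and J the integrals of |z|^(p') and |F|^(p') over the annulus, this reads I ≤ I/p +
  -- J/p'. Since I is finite it can be absorbed, giving I ≤ J.
  have hyoung : -∫ x, inner ℝ (F x) (w x) ∂μ ≤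
      ∫ x, (radialFlux R f ‖x‖ ^ (p / (p - 1)) / p + ‖F x‖ ^ (p / (p - 1)) / (p / (p - 1))) ∂μ := by
    rw [← integral_neg]
    refine integral_mono (integrable_inner_of_memLp hFS hwm).neg
      ((hAi.div_const _).add (hFpS.div_const _)) fun x => ?_
    have hle : ‖w x‖ ≤ radialFlux R f ‖x‖ ^ (1 / (p - 1)) :=
      (norm_smul_unitField_le _ _).trans (Real.norm_of_nonneg (Real.rpow_nonneg (hA0 x) _)).le
    calc -inner ℝ (F x) (w x) ≤ ‖F x‖ * ‖w x‖ := by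
          rw [← inner_neg_left]
          simpa using real_inner_le_norm (-F x) (w x)
      _ ≤ radialFlux R f ‖x‖ ^ (1 / (p - 1)) * ‖F x‖ := by
          rw [mul_comm]; gcongr
      _ ≤ (radialFlux R f ‖x‖ ^ (1 / (p - 1))) ^ p / p + ‖F x‖ ^ (p / (p - 1)) / (p / (p - 1)) :=
          Real.young_inequality_of_nonneg (Real.rpow_nonneg (hA0 x) _) (norm_nonneg _) hconj
      _ = _ := by rw [← Real.rpow_mul (hA0 x), one_div_mul_eq_div]
  rw [heq, neg_neg, integral_add (hAi.div_const _) (hFpS.div_const _), integral_div,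
    integral_div] at hyoung
  have hmono : ∫ x, ‖F x‖ ^ (p / (p - 1)) ∂μ ≤ ∫ x in B N R, ‖F x‖ ^ (p / (p - 1)) :=
    integral_mono_measure hμle (ae_of_all _ fun x => by positivity) hFpB
  refine le_trans ?_ hmono
  set I := ∫ x, radialFlux R f ‖x‖ ^ (p / (p - 1)) ∂μ
  set J := ∫ x, ‖F x‖ ^ (p / (p - 1)) ∂μ
  have h1 : J / (p / (p - 1)) = J * (p - 1) / p := by field_simp
  rw [h1, ← add_div, le_div_iff₀ hp0] at hyoung
  have h2 : I * (p - 1) ≤ J * (p - 1) := by linarith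
  exact le_of_mul_le_mul_right h2 hpm

/-- The bound on the annuli does not depend on ε, so exhausting the punctured ball puts the flux in
L^{p'}. Equivalently its power 1/(p-1), which is the slope minus 1, is in L^p. -/
theorem memLp_gradient_of_negDivEq (hN : 2 ≤ N) (hR : 0 < R) (hp : 1 < p) {F : E N → E N}
    (hF : MemLp F (ENNReal.ofReal (p / (p - 1))) (volume.restrict (B N R)))
    (hdiv : NegDivEq R F f) :
    MemLp (gradient (radialSolution R p f)) (ENNReal.ofReal p) (volume.restrict (B N R)) := by
  have hp0 : 0 < p := by linarith
  have hpm : 0 < p - 1 := by linarith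
  have hmem := ae_restrict_ball_mem (N := N) (R := R) hN
  have hA0 : ∀ x : E N, 0 ≤ radialFlux R f ‖x‖ := fun x => radialFlux_nonneg (norm_nonneg x)
  have hcont : ∀ {q : ℝ}, 0 ≤ q → ContinuousOn (fun x : E N => radialFlux R f ‖x‖ ^ q) {0}ᶜ :=
    fun {q} hq => continuousOn_comp_norm (w := fun r => radialFlux R f r ^ q)
      ((h.continuousOn_radialFlux hN).rpow_const fun _ _ => Or.inr hq)
  have hmeas : ∀ {q : ℝ}, 0 ≤ q →
      AEStronglyMeasurable (fun x : E N => radialFlux R f ‖x‖ ^ q) (volume.restrict (B N R)) :=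
    fun hq => aestronglyMeasurable_of_continuousOn_compl_zero (hcont hq) (hmem.mono fun _ h => h.2)
  refine h.memLp_gradient_of_memLp_flux hN hR hp ?_
  rw [← integrable_norm_rpow_iff (hmeas (by positivity)) (by simpa using hp0)
    ENNReal.ofReal_ne_top, ENNReal.toReal_ofReal hp0.le]
  have hpw : ∀ x : E N, ‖radialFlux R f ‖x‖ ^ (1 / (p - 1))‖ ^ p =
      radialFlux R f ‖x‖ ^ (p / (p - 1)) := fun x => by
    rw [Real.norm_of_nonneg (Real.rpow_nonneg (hA0 x) _), ← Real.rpow_mul (hA0 x),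
      one_div_mul_eq_div]
  simp only [hpw]
  have hcover : AECover (volume.restrict (B N R)) atTop
      (fun n : ℕ => {x : E N | 1 / ((n : ℝ) + 1) < ‖x‖}) := by
    refine ⟨?_, fun n => measurableSet_lt measurable_const measurable_norm⟩
    filter_upwards [hmem] with x hx
    exact (tendsto_one_div_add_atTop_nhds_zero_nat (𝕜 := ℝ)).eventually
      (gt_mem_nhds (norm_pos_iff.2 hx.2))
  have hm : ∀ n : ℕ, MeasurableSet {x : E N | 1 / ((n : ℝ) + 1) < ‖x‖} :=
    fun n => measurableSet_lt measurable_const measurable_norm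
  refine hcover.integrable_of_integral_bounded_of_nonneg_ae
    (∫ x in B N R, ‖F x‖ ^ (p / (p - 1))) (fun n => ?_)
    (ae_of_all _ fun x => Real.rpow_nonneg (hA0 x) _) (Eventually.of_forall fun n => ?_)
  · have hε : (0 : ℝ) < 1 / ((n : ℝ) + 1) := Nat.one_div_pos_of_nat
    have hc : ContinuousOn (fun x : E N => radialFlux R f ‖x‖ ^ (p / (p - 1)))
        (Metric.closedBall 0 R ∩ {x | 1 / ((n : ℝ) + 1) ≤ ‖x‖}) :=
      (hcont (by positivity)).mono fun x hx => norm_pos_iff.1 (hε.trans_le hx.2)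
    have hK : IsCompact (Metric.closedBall (0 : E N) R ∩ {x | 1 / ((n : ℝ) + 1) ≤ ‖x‖}) :=
      (isCompact_closedBall _ _).inter_right (isClosed_le continuous_const continuous_norm)
    rw [IntegrableOn, Measure.restrict_restrict (hm n)]
    refine (hc.integrableOn_compact hK).mono_set fun x hx => ?_
    have hx1 : 1 / ((n : ℝ) + 1) < ‖x‖ := hx.1
    exact ⟨Metric.ball_subset_closedBall hx.2, hx1.le⟩
  · rw [Measure.restrict_restrict (hm n), inter_comm]
    exact h.setIntegral_flux_rpow_le hN hR hp hF hdiv Nat.one_div_pos_of_nat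

theorem isWeakSolution_radialSolution_of_exists (hN : 2 ≤ N) (hR : 0 < R) (hp : 1 < p)
    {u : E N → ℝ} {G : E N → E N} (hu : IsWeakSolution R p f u G) :
    IsWeakSolution R p f (radialSolution R p f) (gradient (radialSolution R p f)) :=
  h.isWeakSolution_radialSolution hN hR hp
    (h.memLp_gradient_of_negDivEq hN hR hp (memLp_H hp hu.memSobolevZero.memLp_grad) hu.equation)

end IsProfile

end Solutions

end WidelyDegenerate

end

theorem mainTheorem6 (N : ℕ) (hN : 2 ≤ N) (R : ℝ) (hR : 0 < R)
    (f : WidelyDegenerate.E N → ℝ)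
    (hf_int : IntegrableOn f (WidelyDegenerate.B N R))
    (hf_nonneg : ∀ᵐ x ∂(volume.restrict (WidelyDegenerate.B N R)), 0 ≤ f x)
    (hf_rad : WidelyDegenerate.IsRadiallyDecreasing R f) :
    -- `f^{**}` is finite, `z` is integrable, and `-div z = f`
    (∀ t : ℝ, 0 < t → WidelyDegenerate.maximalFunction (WidelyDegenerate.B N R) f t < ⊤) ∧
    IntegrableOn (WidelyDegenerate.z R f) (WidelyDegenerate.B N R) ∧
    WidelyDegenerate.NegDivEq R (WidelyDegenerate.z R f) f ∧
    ∀ p : ℝ, 1 < p →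
      -- every solution has flux `z`, and where its gradient exceeds `1` in modulus
      -- this gradient is the one of the explicit radial function
      (∀ (u : WidelyDegenerate.E N → ℝ) (G : WidelyDegenerate.E N → WidelyDegenerate.E N),
        WidelyDegenerate.IsWeakSolution R p f u G →
          ∀ᵐ x ∂(volume.restrict (WidelyDegenerate.B N R)),
            WidelyDegenerate.H (p - 1) (G x) = WidelyDegenerate.z R f x ∧
            (1 < ‖G x‖ → G x = gradient (WidelyDegenerate.radialSolution R p f) x)) ∧
      -- the explicit radial function, its gradient and its flux
      ContinuousOn (WidelyDegenerate.radialSolution R p f)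
        (Metric.closedBall (0 : WidelyDegenerate.E N) R \ {0}) ∧
      (∀ x ∈ Metric.sphere (0 : WidelyDegenerate.E N) R,
        WidelyDegenerate.radialSolution R p f x = 0) ∧
      (∀ x ∈ WidelyDegenerate.B N R, x ≠ 0 →
        HasGradientAt (WidelyDegenerate.radialSolution R p f)
          (-((1 + (‖x‖ / N * (WidelyDegenerate.maximalFunction (WidelyDegenerate.B N R) f
            (WidelyDegenerate.C N * ‖x‖ ^ N)).toReal) ^ (1 / (p - 1))) • (‖x‖⁻¹ • x))) x) ∧
      (∀ x ∈ WidelyDegenerate.B N R, x ≠ 0 →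
        WidelyDegenerate.H (p - 1) (gradient (WidelyDegenerate.radialSolution R p f) x)
          = WidelyDegenerate.z R f x) ∧
      WidelyDegenerate.NegDivEq R
        (fun x => WidelyDegenerate.H (p - 1)
          (gradient (WidelyDegenerate.radialSolution R p f) x)) f ∧
      -- the explicit radial function is a solution as soon as there is one at all,
      -- as soon as its gradient is `p`-integrable, and in particular if `f ∈ L^{N,∞}(B_R)`
      ((∃ (u : WidelyDegenerate.E N → ℝ) (G : WidelyDegenerate.E N → WidelyDegenerate.E N),
          WidelyDegenerate.IsWeakSolution R p f u G) →
        WidelyDegenerate.IsWeakSolution R p f (WidelyDegenerate.radialSolution R p f)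
          (gradient (WidelyDegenerate.radialSolution R p f))) ∧
      (MemLp (gradient (WidelyDegenerate.radialSolution R p f)) (ENNReal.ofReal p)
          (volume.restrict (WidelyDegenerate.B N R)) →
        WidelyDegenerate.IsWeakSolution R p f (WidelyDegenerate.radialSolution R p f)
          (gradient (WidelyDegenerate.radialSolution R p f))) ∧
      (WidelyDegenerate.weakLorentzNorm (WidelyDegenerate.B N R) N f < ⊤ →
        WidelyDegenerate.IsWeakSolution R p f (WidelyDegenerate.radialSolution R p f)
          (gradient (WidelyDegenerate.radialSolution R p f))) := by
  obtain ⟨g, h⟩ := WidelyDegenerate.exists_isProfile hN hf_int hf_nonneg hf_rad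
  refine ⟨fun t ht => h.maximalFunction_lt_top hN ht, h.integrableOn_z hN, h.negDivEq_z hN hR,
    fun p hp => ⟨fun u G hu => ?_, ?_, fun x hx => ?_, fun x _ hx0 => ?_, fun x _ hx0 => ?_, ?_, ?_,
      h.isWeakSolution_radialSolution hN hR hp, fun hK => ?_⟩⟩
  -- The existence of u already makes ũ_p a solution, so u can be compared with it.
  · have hH := hu.H_ae_eq hp (h.isWeakSolution_radialSolution_of_exists hN hR hp hu)
    filter_upwards [hH, WidelyDegenerate.ae_restrict_ball_mem hN] with x hx hx0
    exact ⟨hx.trans (h.H_gradient_radialSolution hN hR hp hx0.2),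
      fun h1 => WidelyDegenerate.eq_of_H_eq (by linarith) h1 hx⟩
  · exact (h.continuousOn_radialSolution hN hR hp).mono fun x hx => hx.2
  · rw [WidelyDegenerate.radialSolution_eq, mem_sphere_zero_iff_norm.1 hx]
    exact WidelyDegenerate.radialProfile_self
  · exact h.hasGradientAt_radialSolution hN hR hp hx0
  · exact h.H_gradient_radialSolution hN hR hp hx0
  · exact h.negDivEq_H_gradient_radialSolution hN hR hp
  · rintro ⟨u, G, hu⟩
    exact h.isWeakSolution_radialSolution_of_exists hN hR hp hu
  · exact h.isWeakSolution_radialSolution hN hR hp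
      (h.memLp_gradient_of_weakLorentzNorm hN hR hp hK)
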